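/- Let $n \ge 1$ be an integer, let $(a,b) \subseteq \mathbb{R}$ be an open interval, with $-\infty \le a$ and $b \le \infty$, and let $f : (a,b) \to \mathbb{R}$ be any function. We say that $f$ is $n$-convex if for all $n \times n$ complex Hermitian matrices $A, B$ with $aI < A < bI$ and $aI < B < bI$ (that is, with all eigenvalues in $(a,b)$) and all $t \in [0,1]$ one has $$f(tA + (1-t)B) \le t f(A) + (1-t) f(B)$$ in the Loewner order, where $f(A)$ is obtained by applying $f$ to the eigenvalues of $A$ in a spectral decomposition. For a function $g : (a,b) \to \mathbb{R}$ and pairwise distinct $x_0, \ldots, x_m \in (a,b)$, the divided differences are defined recursively by $[x_0]_g = g(x_0)$ and $$[x_0, \ldots, x_m]_g = \frac{[x_0, \ldots, x_{m-1}]_g - [x_1, \ldots, x_m]_g}{x_0 - x_m} \qquad (m \ge 1).$$ Then $f$ is $n$-convex if and only if for every real polynomial $q$ of degree at most $n-1$ and all pairwise distinct $x_0, x_1, \ldots, x_{2n} \in (a,b)$ one has $$[x_0, x_1, \ldots, x_{2n}]_{f q^2} \ge 0.$$ -/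

import Mathlib

open scoped MatrixOrder ComplexOrder

/-- The open interval `(a, b)` of the real line; the end points may be infinite. -/
def openInterval (a b : EReal) : Set ℝ :=
  {x : ℝ | a < (x : EReal) ∧ (x : EReal) < b}

/-- `f` is `n`-convex (matrix convex of order `n`) on `(a, b)`: for all `n × n` complex Hermitian
matrices `A`, `B` with `aI < A, B < bI` (that is, with all eigenvalues in `(a, b)`) and all
`t ∈ [0, 1]`, `f (t A + (1 - t) B) ≤ t f (A) + (1 - t) f (B)` in the Loewner order.
Here `cfc f A` is `f (A)`, the function `f` applied to the eigenvalues of `A`; the spectra are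
finite, so there is no continuity requirement on `f`, and only the values of `f` on `(a, b)`
matter. -/
def MatrixConvexOfOrder (n : ℕ) (a b : EReal) (f : ℝ → ℝ) : Prop :=
  ∀ A B : Matrix (Fin n) (Fin n) ℂ, A.IsHermitian → B.IsHermitian →
    spectrum ℝ A ⊆ openInterval a b → spectrum ℝ B ⊆ openInterval a b →
    ∀ t : ℝ, 0 ≤ t → t ≤ 1 →
      cfc f (t • A + (1 - t) • B) ≤ t • cfc f A + (1 - t) • cfc f B

/-- The divided difference `[x₀, …, x_m]_g` of order `m`, defined recursively (used for pairwise
distinct points). -/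
noncomputable def dividedDifference (g : ℝ → ℝ) : (m : ℕ) → (Fin (m + 1) → ℝ) → ℝ
  | 0, x => g (x 0)
  | m + 1, x =>
      (dividedDifference g m (fun i => x i.castSucc) - dividedDifference g m (fun i => x i.succ)) /
        (x 0 - x (Fin.last (m + 1)))

/-! Both conditions are equivalent to a third: `f` is convex and, for points `s i` and `μ` of the
interval, the matrix `secantGap f m μ (s i) (s j)` is positive semidefinite, where `m` supplies a
slope of `f` at each `s i`. Formally this entry is `(μ - s i) (μ - s j) [μ, s i, s j]_f`.

Link with divided differences: if `q = ∑ c i ∏_{j ≠ i} (X - s j)`, then `q² / ∏ (X - s j)² = ∑ c i c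
j / ((X - s i) (X - s j))`. Hence the divided difference of `f q²` at `μ` and the doubled nodes `s
i` is `∑ c i c j [μ, s i, s j]_f`. This is `tendsto_finsetDividedDifference_pairNodes`, phrased with
pairs of distinct nodes that coalesce, since `f` need not be differentiable.

Link with matrices: the form of `f(M)` is that of `f(C)`, plus a linear term in `M - C`, plus
exactly a sum over the eigenvalues `μ k` of `M` of secant gap forms
(`dotProduct_spectralMatrix_eq`).

If the divided differences are nonnegative, lowering the order (`of_succ`) gives convexity, hence
one-sided derivatives; coalescing pairs make the gap matrices positive semidefinite, and expanding
`f(A)` and `f(B)` about `t A + (1 - t) B` cancels the linear terms. Conversely, matrix convexity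
along a segment that starts at `C` gives a nonnegative remainder (`gapForm_nonneg`), because near
`C` the remainder is at least `-K s²`. Near-diagonal reflections extract the gap form of a single
`μ`. A negative divided difference with distinct nodes would, by repeated bisection of pairs,
survive in the limit of double nodes, where it is a gap form (`exists_narrow_pairs`). -/

open Filter Topology

/-! ### Divided differences in Lagrange form. -/

/-- The divided difference of `g` with the elements of the finite set `s` as nodes, in its
Lagrange form. -/
noncomputable def finsetDividedDifference (g : ℝ → ℝ) (s : Finset ℝ) : ℝ :=
  ∑ y ∈ s, g y / ∏ z ∈ s.erase y, (y - z)

theorem finsetDividedDifference_insert (g : ℝ → ℝ) {T : Finset ℝ} {y : ℝ} (hy : y ∉ T) :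
    finsetDividedDifference g (insert y T) =
      g y / ∏ z ∈ T, (y - z) + ∑ r ∈ T, g r / ((r - y) * ∏ z ∈ T.erase r, (r - z)) := by
  unfold finsetDividedDifference
  rw [Finset.sum_insert hy, Finset.erase_insert hy]
  congr 1
  refine Finset.sum_congr rfl fun r hr => ?_
  have hne : y ≠ r := fun h => hy (h ▸ hr)
  rw [Finset.erase_insert_of_ne hne, Finset.prod_insert (fun h => hy (Finset.mem_of_mem_erase h))]

theorem finsetDividedDifference_insert_insert (g : ℝ → ℝ) {T : Finset ℝ} {y z : ℝ}
    (hy : y ∉ T) (hz : z ∉ T) (hyz : y ≠ z) :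
    finsetDividedDifference g (insert y (insert z T)) =
      (finsetDividedDifference g (insert y T) - finsetDividedDifference g (insert z T)) /
        (y - z) := by
  have hy' : y ∉ insert z T := by simp [hyz, hy]
  have hyz' : y - z ≠ 0 := sub_ne_zero.2 hyz
  have hzy' : z - y ≠ 0 := sub_ne_zero.2 hyz.symm
  rw [finsetDividedDifference_insert g hy', Finset.sum_insert hz, Finset.erase_insert hz,
    Finset.prod_insert hz, finsetDividedDifference_insert g hy, finsetDividedDifference_insert g hz]
  have hsum : ∑ r ∈ T, g r / ((r - y) * ∏ w ∈ (insert z T).erase r, (r - w)) =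
      (∑ r ∈ T, g r / ((r - y) * ∏ w ∈ T.erase r, (r - w)) -
        ∑ r ∈ T, g r / ((r - z) * ∏ w ∈ T.erase r, (r - w))) / (y - z) := by
    rw [← Finset.sum_sub_distrib, Finset.sum_div]
    refine Finset.sum_congr rfl fun r hr => ?_
    have hzr : z ≠ r := fun h => hz (h ▸ hr)
    have hry : r - y ≠ 0 := sub_ne_zero.2 fun h => hy (h ▸ hr)
    have hrz : r - z ≠ 0 := sub_ne_zero.2 fun h => hz (h ▸ hr)
    have hp : ∏ w ∈ T.erase r, (r - w) ≠ 0 :=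
      Finset.prod_ne_zero_iff.2 fun w hw => sub_ne_zero.2 (Finset.ne_of_mem_erase hw).symm
    rw [Finset.erase_insert_of_ne hzr,
      Finset.prod_insert (fun h => hz (Finset.mem_of_mem_erase h))]
    field_simp
    ring
  rw [hsum]
  have hpy : ∏ w ∈ T, (y - w) ≠ 0 :=
    Finset.prod_ne_zero_iff.2 fun w hw => sub_ne_zero.2 fun h => hy (h ▸ hw)
  have hpz : ∏ w ∈ T, (z - w) ≠ 0 :=
    Finset.prod_ne_zero_iff.2 fun w hw => sub_ne_zero.2 fun h => hz (h ▸ hw)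
  have e : g z / ((z - y) * ∏ w ∈ T, (z - w)) = -(g z / ∏ w ∈ T, (z - w)) / (y - z) := by
    rw [← neg_sub y z]; field_simp
  have e' : g y / ((y - z) * ∏ w ∈ T, (y - w)) = (g y / ∏ w ∈ T, (y - w)) / (y - z) := by
    field_simp
  rw [e, e']
  ring

/-- The Lagrange form is symmetric in the nodes, so the recursion may single out any two of them;
this freedom allows the nodes to be regrouped into pairs. -/
theorem dividedDifference_eq_finset (g : ℝ → ℝ) (m : ℕ) (x : Fin (m + 1) → ℝ)
    (hx : Function.Injective x) :
    dividedDifference g m x = finsetDividedDifference g (Finset.univ.image x) := by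
  induction m with
  | zero => simp [dividedDifference, finsetDividedDifference]
  | succ m ih =>
    rw [dividedDifference, ih (fun i => x i.castSucc) (hx.comp (Fin.castSucc_injective _)),
      ih (fun i => x i.succ) (hx.comp (Fin.succ_injective _))]
    set T : Finset ℝ := Finset.univ.image fun i : Fin m => x i.succ.castSucc with hT
    have h0 : x 0 ∉ T := by
      simp only [hT, Finset.mem_image, Finset.mem_univ, true_and, not_exists]
      intro i hi
      have h := congrArg Fin.val (hx hi)
      simp at h
    have hl : x (Fin.last (m + 1)) ∉ T := by
      simp only [hT, Finset.mem_image, Finset.mem_univ, true_and, not_exists]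
      intro i hi
      have h := congrArg Fin.val (hx hi)
      simp at h
      omega
    have h0l : x 0 ≠ x (Fin.last (m + 1)) := fun h => by
      have h := congrArg Fin.val (hx h)
      simp at h
    have e1 : (Finset.univ.image fun i : Fin (m + 1) => x i.castSucc) = insert (x 0) T := by
      rw [Fin.univ_succ, Finset.cons_eq_insert, Finset.image_insert, Finset.map_eq_image, Finset.image_image]
      rfl
    have e2 : (Finset.univ.image fun i : Fin (m + 1) => x i.succ) =
        insert (x (Fin.last (m + 1))) T := by
      rw [Fin.univ_castSuccEmb, Finset.cons_eq_insert, Finset.image_insert, Finset.map_eq_image, Finset.image_image]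
      rfl
    have e3 : Finset.univ.image x = insert (x 0) (insert (x (Fin.last (m + 1))) T) := by
      rw [Fin.univ_succ, Finset.cons_eq_insert, Finset.image_insert, Finset.map_eq_image, Finset.image_image, ← e2]
      rfl
    rw [e3, finsetDividedDifference_insert_insert g h0 hl h0l]
    congr 2
    · exact congrArg _ e1
    · exact congrArg _ e2

theorem finsetDividedDifference_image (g : ℝ → ℝ) {ι : Type*} [Fintype ι] [DecidableEq ι]
    (x : ι → ℝ) (hx : Function.Injective x) :
    finsetDividedDifference g (Finset.univ.image x) =
      ∑ i, g (x i) / ∏ j, if j = i then 1 else x i - x j := by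
  unfold finsetDividedDifference
  rw [Finset.sum_image fun a _ b _ h => hx h]
  refine Finset.sum_congr rfl fun i _ => ?_
  rw [← Finset.image_erase hx, Finset.prod_image fun a _ b _ h => hx h,
    ← Finset.mul_prod_erase Finset.univ (fun j => if j = i then 1 else x i - x j)
      (Finset.mem_univ i)]
  simp only [if_true, one_mul]
  congr 1
  exact Finset.prod_congr rfl fun j hj => by rw [if_neg (Finset.ne_of_mem_erase hj)]

/-- The divided differences of order `2n` of the functions `f q²`, `deg q < n`, are nonnegative
on `(a, b)`, with finite sets of nodes. -/
def DividedDifferenceCondition (n : ℕ) (a b : EReal) (f : ℝ → ℝ) : Prop :=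
  ∀ q : Polynomial ℝ, q.natDegree ≤ n - 1 → ∀ s : Finset ℝ, s.card = 2 * n + 1 →
    (∀ y ∈ s, y ∈ openInterval a b) →
      0 ≤ finsetDividedDifference (fun y => f y * q.eval y ^ 2) s

theorem dividedDifferenceCondition_iff (n : ℕ) (a b : EReal) (f : ℝ → ℝ) :
    DividedDifferenceCondition n a b f ↔
      ∀ q : Polynomial ℝ, q.natDegree ≤ n - 1 →
        ∀ x : Fin (2 * n + 1) → ℝ, Function.Injective x → (∀ i, x i ∈ openInterval a b) →
          0 ≤ dividedDifference (fun y => f y * q.eval y ^ 2) (2 * n) x := by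
  constructor
  · intro h q hq x hx hxI
    rw [dividedDifference_eq_finset _ _ _ hx]
    refine h q hq _ ?_ ?_
    · rw [Finset.card_image_of_injective _ hx, Finset.card_univ, Fintype.card_fin]
    · simpa using hxI
  · intro h q hq s hs hsI
    have h1 := h q hq (fun i => s.orderEmbOfFin hs i) (s.orderEmbOfFin hs).injective
      fun i => hsI _ (s.orderEmbOfFin_mem hs i)
    rwa [dividedDifference_eq_finset _ _ _ (s.orderEmbOfFin hs).injective,
      Finset.image_orderEmbOfFin_univ] at h1

/-! ### Node sets made of `n` pairs and one single node. -/

/-- The pairs `y i`, `y' i` and the node `μ` are pairwise distinct. -/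
def PairsDistinct {n : ℕ} (y y' : Fin n → ℝ) (μ : ℝ) : Prop :=
  Function.Injective y ∧ Function.Injective y' ∧ (∀ i j, y i ≠ y' j) ∧
    (∀ i, y i ≠ μ) ∧ ∀ i, y' i ≠ μ

theorem PairsDistinct.injective {n : ℕ} {y y' : Fin n → ℝ} {μ : ℝ} (h : PairsDistinct y y' μ) :
    Function.Injective (fun o : Option (Fin n ⊕ Fin n) => o.elim μ (Sum.elim y y')) := by
  obtain ⟨h1, h2, h3, h4, h5⟩ := h
  rintro (_ | i | i) (_ | j | j) hij <;> simp only [Option.elim, Sum.elim_inl, Sum.elim_inr] at hij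
  · rfl
  · exact absurd hij.symm (h4 j)
  · exact absurd hij.symm (h5 j)
  · exact absurd hij (h4 i)
  · rw [h1 hij]
  · exact absurd hij (h3 i j)
  · exact absurd hij (h5 i)
  · exact absurd hij.symm (h3 j i)
  · rw [h2 hij]

/-- The node set made of the pairs `y i`, `y' i` and a single node `μ`. -/
noncomputable def pairNodes {n : ℕ} (y y' : Fin n → ℝ) (μ : ℝ) : Finset ℝ :=
  insert μ (Finset.univ.image y ∪ Finset.univ.image y')

theorem pairNodes_eq_image {n : ℕ} (y y' : Fin n → ℝ) (μ : ℝ) :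
    pairNodes y y' μ =
      Finset.univ.image (fun o : Option (Fin n ⊕ Fin n) => o.elim μ (Sum.elim y y')) := by
  ext z
  simp [pairNodes, Option.exists, Sum.exists, eq_comm]

theorem card_pairNodes {n : ℕ} {y y' : Fin n → ℝ} {μ : ℝ} (h : PairsDistinct y y' μ) :
    (pairNodes y y' μ).card = 2 * n + 1 := by
  rw [pairNodes_eq_image, Finset.card_image_of_injective _ h.injective]
  simp
  ring

/-- The two Lagrange terms of a pair may blow up separately as the pair coalesces. Together they are
a difference quotient of one function, which can have a limit. -/
theorem finsetDividedDifference_pairNodes (g : ℝ → ℝ) {n : ℕ} {y y' : Fin n → ℝ} {μ : ℝ}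
    (h : PairsDistinct y y' μ) :
    finsetDividedDifference g (pairNodes y y' μ) =
      g μ / ∏ j, ((μ - y j) * (μ - y' j)) +
        ∑ i, (g (y' i) / ((y' i - μ) * ∏ j ∈ Finset.univ.erase i, ((y' i - y j) * (y' i - y' j))) -
          g (y i) / ((y i - μ) * ∏ j ∈ Finset.univ.erase i, ((y i - y j) * (y i - y' j)))) /
            (y' i - y i) := by
  rw [pairNodes_eq_image, finsetDividedDifference_image _ _ h.injective]
  simp only [Fintype.sum_option, Fintype.sum_sum_type, Fintype.prod_option,
    Fintype.prod_sum_type, Option.elim, Sum.elim_inl, Sum.elim_inr]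
  simp only [reduceCtorEq, if_false, if_true, one_mul, Option.some.injEq, Sum.inl.injEq,
    Sum.inr.injEq]
  rw [Finset.prod_mul_distrib, ← Finset.sum_add_distrib]
  congr 1
  refine Finset.sum_congr rfl fun i _ => ?_
  obtain ⟨h1, h2, h3, h4, h5⟩ := h
  have key : ∀ (w : Fin n → ℝ) (c : ℝ), (∏ j, if j = i then 1 else c - w j) =
      ∏ j ∈ Finset.univ.erase i, (c - w j) := by
    intro w c
    rw [← Finset.mul_prod_erase Finset.univ _ (Finset.mem_univ i)]
    simp only [if_true, one_mul]
    exact Finset.prod_congr rfl fun j hj => by rw [if_neg (Finset.ne_of_mem_erase hj)]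
  rw [key, key, ← Finset.mul_prod_erase Finset.univ (fun j => y i - y' j) (Finset.mem_univ i),
    ← Finset.mul_prod_erase Finset.univ (fun j => y' i - y j) (Finset.mem_univ i),
    Finset.prod_mul_distrib, Finset.prod_mul_distrib]
  have hne : y' i - y i ≠ 0 := sub_ne_zero.2 (h3 i i).symm
  have e1 : y i - y' i = -(y' i - y i) := by ring
  rw [e1, sub_div, div_div, div_div]
  set D := y' i - y i
  rw [show (y i - μ) * ((∏ j ∈ Finset.univ.erase i, (y i - y j)) *
    (-D * ∏ j ∈ Finset.univ.erase i, (y i - y' j))) = -((y i - μ) *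
    ((∏ j ∈ Finset.univ.erase i, (y i - y j)) * ∏ j ∈ Finset.univ.erase i, (y i - y' j)) * D) by
      ring, div_neg]
  rw [show (y' i - μ) * (D * (∏ j ∈ Finset.univ.erase i, (y' i - y j)) *
    ∏ j ∈ Finset.univ.erase i, (y' i - y' j)) = (y' i - μ) *
    ((∏ j ∈ Finset.univ.erase i, (y' i - y j)) * ∏ j ∈ Finset.univ.erase i, (y' i - y' j)) * D by
      ring]
  ring

/-! ### Differential calculus for coalescing pairs of points. -/

/-- Along `l`, the functions `u k` have values tending to `a` at both points `y k`, `y' k`, and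
difference quotients between these points tending to `a'`. -/
def PairTendsto {α : Type*} (l : Filter α) (y y' : α → ℝ) (u : α → ℝ → ℝ) (a a' : ℝ) : Prop :=
  Tendsto (fun k => u k (y k)) l (𝓝 a) ∧ Tendsto (fun k => u k (y' k)) l (𝓝 a) ∧
    Tendsto (fun k => (u k (y' k) - u k (y k)) / (y' k - y k)) l (𝓝 a')

namespace PairTendsto

variable {α : Type*} {l : Filter α} {y y' : α → ℝ} {u v : α → ℝ → ℝ} {a a' b b' : ℝ}

theorem const (c : ℝ) : PairTendsto l y y' (fun _ _ => c) c 0 := by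
  refine ⟨tendsto_const_nhds, tendsto_const_nhds, ?_⟩
  simpa using tendsto_const_nhds

theorem add (hu : PairTendsto l y y' u a a') (hv : PairTendsto l y y' v b b') :
    PairTendsto l y y' (fun k x => u k x + v k x) (a + b) (a' + b') := by
  refine ⟨hu.1.add hv.1, hu.2.1.add hv.2.1, (hu.2.2.add hv.2.2).congr fun k => ?_⟩
  ring

theorem mul (hu : PairTendsto l y y' u a a') (hv : PairTendsto l y y' v b b') :
    PairTendsto l y y' (fun k x => u k x * v k x) (a * b) (a * b' + b * a') := by
  refine ⟨hu.1.mul hv.1, hu.2.1.mul hv.2.1,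
    ((hu.2.1.mul hv.2.2).add (hv.1.mul hu.2.2)).congr fun k => ?_⟩
  ring

theorem inv (hu : PairTendsto l y y' u a a') (ha : a ≠ 0) :
    PairTendsto l y y' (fun k x => (u k x)⁻¹) a⁻¹ (-a' / a ^ 2) := by
  refine ⟨hu.1.inv₀ ha, hu.2.1.inv₀ ha, ?_⟩
  have h := (hu.2.2.neg).div (hu.1.mul hu.2.1) (mul_ne_zero ha ha)
  rw [pow_two]
  refine h.congr' ?_
  filter_upwards [hu.1.eventually_ne ha, hu.2.1.eventually_ne ha] with k h1 h2
  rw [inv_sub_inv h2 h1]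
  simp only [Pi.div_apply]
  field_simp
  ring

theorem congr (hu : PairTendsto l y y' u a a') (h : ∀ᶠ k in l, u k (y k) = v k (y k))
    (h' : ∀ᶠ k in l, u k (y' k) = v k (y' k)) : PairTendsto l y y' v a a' := by
  refine ⟨hu.1.congr' h, hu.2.1.congr' h', hu.2.2.congr' ?_⟩
  filter_upwards [h, h'] with k e e'
  rw [e, e']

theorem sub_param {s c : ℝ} {z : α → ℝ} (hy : Tendsto y l (𝓝 s)) (hy' : Tendsto y' l (𝓝 s))
    (hne : ∀ᶠ k in l, y k ≠ y' k) (hz : Tendsto z l (𝓝 c)) :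
    PairTendsto l y y' (fun k x => x - z k) (s - c) 1 := by
  refine ⟨hy.sub hz, hy'.sub hz, tendsto_const_nhds.congr' ?_⟩
  filter_upwards [hne] with k hk
  have : y' k - y k ≠ 0 := sub_ne_zero.2 hk.symm
  rw [sub_sub_sub_cancel_right, div_self this]

theorem sum {κ : Type*} (t : Finset κ) {w : κ → α → ℝ → ℝ} {c c' : κ → ℝ}
    (h : ∀ i ∈ t, PairTendsto l y y' (w i) (c i) (c' i)) :
    PairTendsto l y y' (fun k x => ∑ i ∈ t, w i k x) (∑ i ∈ t, c i) (∑ i ∈ t, c' i) := by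
  classical
  induction t using Finset.induction_on with
  | empty => simpa using const 0
  | insert i t hi ih =>
    simp only [Finset.sum_insert hi]
    exact (h i (Finset.mem_insert_self i t)).add
      (ih fun j hj => h j (Finset.mem_insert_of_mem hj))

/-- Only factors `(x - s j) / (x - z)` with `z` tending to `s j` are multiplied later; their value
tends to 1 and their slope to 0, so no general Leibniz formula is needed. -/
theorem prod_one {κ : Type*} (t : Finset κ) {w : κ → α → ℝ → ℝ}
    (h : ∀ i ∈ t, PairTendsto l y y' (w i) 1 0) :
    PairTendsto l y y' (fun k x => ∏ i ∈ t, w i k x) 1 0 := by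
  classical
  induction t using Finset.induction_on with
  | empty => simpa using const 1
  | insert i t hi ih =>
    simp only [Finset.prod_insert hi]
    simpa using (h i (Finset.mem_insert_self i t)).mul
      (ih fun j hj => h j (Finset.mem_insert_of_mem hj))

end PairTendsto

/-! ### Secant gaps and divided differences at double nodes. -/

/-- The divided difference of order one, with value `m x` at a double node `x`. -/
noncomputable def secantSlope (f m : ℝ → ℝ) (x y : ℝ) : ℝ :=
  if x = y then m x else (f x - f y) / (x - y)

/-- The distance of `f μ` from the value at `μ` of the line through the points of the graph over
`x` and `y`. -/
noncomputable def secantGap (f m : ℝ → ℝ) (μ x y : ℝ) : ℝ :=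
  f μ - f x - (μ - x) * secantSlope f m x y

theorem secantSlope_comm (f m : ℝ → ℝ) (x y : ℝ) : secantSlope f m x y = secantSlope f m y x := by
  unfold secantSlope
  by_cases h : x = y
  · simp [h]
  · rw [if_neg h, if_neg (Ne.symm h), ← neg_sub (f y), ← neg_sub y, neg_div_neg_eq]

theorem secantGap_comm (f m : ℝ → ℝ) (μ x y : ℝ) : secantGap f m μ x y = secantGap f m μ y x := by
  unfold secantGap
  rw [secantSlope_comm f m y x]
  by_cases h : x = y
  · simp [h]
  · have : x - y ≠ 0 := sub_ne_zero.2 h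
    rw [secantSlope, if_neg h]
    field_simp
    ring

theorem secantGap_self_left (f m : ℝ → ℝ) (x y : ℝ) : secantGap f m x x y = 0 := by
  simp [secantGap]

theorem secantGap_self_right (f m : ℝ → ℝ) (x y : ℝ) : secantGap f m y x y = 0 := by
  rw [secantGap_comm, secantGap_self_left]

/-- For `i ≠ j` the secant takes at `μ` the value `f (s i) (μ - s j) / (s i - s j)` plus the same
with `i` and `j` exchanged. Collecting the coefficients of each `f (s i)` and `m (s i)` gives the
shape in which the limit of divided differences appears. -/
theorem sum_secantGap_eq (f m : ℝ → ℝ) {n : ℕ} {s : Fin n → ℝ} (hs : Function.Injective s)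
    {μ : ℝ} (d : Fin n → ℝ) :
    ∑ i, ∑ j, d i * d j * secantGap f m μ (s i) (s j) =
      f μ * (∑ i, d i) ^ 2 - ∑ i, (f (s i) * (d i ^ 2 + 2 * d i *
        ∑ j ∈ Finset.univ.erase i, d j * (μ - s j) / (s i - s j)) +
          m (s i) * (d i ^ 2 * (μ - s i))) := by
  have hsplit : ∀ i j, d i * d j * secantGap f m μ (s i) (s j) = d i * d j * f μ -
      ((if j = i then d i ^ 2 * (f (s i) + m (s i) * (μ - s i)) else 0) +
      ((if j = i then 0 else f (s i) * d i * (d j * (μ - s j) / (s i - s j))) +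
        if i = j then 0 else f (s j) * d j * (d i * (μ - s i) / (s j - s i)))) := by
    intro i j
    by_cases h : j = i
    · subst h
      simp only [secantGap, secantSlope, if_true]
      ring
    · have h1 : s i - s j ≠ 0 := sub_ne_zero.2 fun e => h (hs e).symm
      have h2 : s j - s i ≠ 0 := sub_ne_zero.2 fun e => h (hs e)
      rw [secantGap, secantSlope, if_neg (fun e => h (hs e).symm), if_neg h, if_neg h,
        if_neg (Ne.symm h)]
      rw [show s j - s i = -(s i - s j) by ring]
      field_simp
      ring
  simp only [hsplit, Finset.sum_sub_distrib, Finset.sum_add_distrib]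
  have e3 : ∑ i, ∑ j, (if i = j then 0 else f (s j) * d j * (d i * (μ - s i) / (s j - s i))) =
      ∑ i, ∑ j, (if j = i then 0 else f (s i) * d i * (d j * (μ - s j) / (s i - s j))) := by
    rw [Finset.sum_comm]
  have e2 : ∀ i, ∑ j, (if j = i then 0 else f (s i) * d i * (d j * (μ - s j) / (s i - s j))) =
      f (s i) * d i * ∑ j ∈ Finset.univ.erase i, d j * (μ - s j) / (s i - s j) := by
    intro i
    rw [← Finset.add_sum_erase Finset.univ _ (Finset.mem_univ i)]
    simp only [if_true, zero_add]
    rw [Finset.mul_sum]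
    exact Finset.sum_congr rfl fun j hj => by rw [if_neg (Finset.ne_of_mem_erase hj)]
  have e1 : ∑ i, ∑ j, d i * d j * f μ = f μ * (∑ i, d i) ^ 2 := by
    rw [pow_two, Finset.sum_mul_sum, Finset.mul_sum]
    refine Finset.sum_congr rfl fun i _ => ?_
    rw [Finset.mul_sum]
    exact Finset.sum_congr rfl fun j _ => by ring
  rw [e3, e1]
  simp only [e2, Finset.sum_ite_eq', Finset.mem_univ, if_true]
  rw [← Finset.sum_add_distrib, ← Finset.sum_add_distrib, ← Finset.sum_add_distrib]
  congr 1
  refine Finset.sum_congr rfl fun i _ => ?_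
  ring

/-- The coefficients of `q` in the Lagrange basis of the monic polynomials `∏ j ≠ i, (X - s j)`. -/
noncomputable def lagrangeCoeff (q : Polynomial ℝ) {n : ℕ} (s : Fin n → ℝ) (i : Fin n) : ℝ :=
  q.eval (s i) / ∏ j ∈ Finset.univ.erase i, (s i - s j)

theorem eval_eq_sum_lagrangeCoeff (q : Polynomial ℝ) {n : ℕ} (hq : q.degree < n)
    {s : Fin n → ℝ} (hs : Function.Injective s) (x : ℝ) :
    q.eval x = ∑ i, lagrangeCoeff q s i * ∏ j ∈ Finset.univ.erase i, (x - s j) := by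
  have h := Lagrange.eq_interpolate (s := Finset.univ) (v := s) (f := q)
    (fun a _ b _ e => hs e) (by simpa using hq)
  conv_lhs => rw [h]
  rw [Lagrange.interpolate_apply, Polynomial.eval_finsetSum]
  refine Finset.sum_congr rfl fun i _ => ?_
  rw [Polynomial.eval_mul, Polynomial.eval_C, Lagrange.basis, Polynomial.eval_prod, lagrangeCoeff]
  simp only [Lagrange.basisDivisor, Polynomial.eval_mul, Polynomial.eval_C, Polynomial.eval_sub,
    Polynomial.eval_X]
  rw [Finset.prod_mul_distrib, Finset.prod_inv_distrib]
  ring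

/-- The case `x = s i` is allowed, since one node of a pair may stay at its limit. -/
theorem eval_eq_prod_erase_mul (q : Polynomial ℝ) {n : ℕ} (hq : q.degree < n)
    {s : Fin n → ℝ} (hs : Function.Injective s) (i : Fin n) {x : ℝ} (hx : ∀ j, j ≠ i → x ≠ s j) :
    q.eval x = (∏ j ∈ Finset.univ.erase i, (x - s j)) *
      (lagrangeCoeff q s i +
        (x - s i) * ∑ j ∈ Finset.univ.erase i, lagrangeCoeff q s j * (x - s j)⁻¹) := by
  rw [eval_eq_sum_lagrangeCoeff q hq hs, ← Finset.add_sum_erase Finset.univ _ (Finset.mem_univ i),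
    mul_add, mul_comm (lagrangeCoeff q s i)]
  congr 1
  rw [Finset.mul_sum, Finset.mul_sum]
  refine Finset.sum_congr rfl fun k hk => ?_
  have hki := Finset.ne_of_mem_erase hk
  have hxk : x - s k ≠ 0 := sub_ne_zero.2 (hx k hki)
  rw [← Finset.mul_prod_erase (Finset.univ.erase k) (fun j => x - s j)
      (Finset.mem_erase.2 ⟨hki.symm, Finset.mem_univ i⟩),
    ← Finset.mul_prod_erase (Finset.univ.erase i) (fun j => x - s j) hk, Finset.erase_right_comm]
  field_simp

theorem tendsto_finsetDividedDifference_pairNodes {α : Type*} {l : Filter α} {n : ℕ}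
    {y y' : α → Fin n → ℝ} {s : Fin n → ℝ} {μ : ℝ} {f m : ℝ → ℝ} {q : Polynomial ℝ}
    (hq : q.degree < n) (hs : Function.Injective s) (hμ : ∀ i, s i ≠ μ)
    (hdist : ∀ᶠ k in l, PairsDistinct (y k) (y' k) μ)
    (hy : ∀ i, Tendsto (fun k => y k i) l (𝓝 (s i)))
    (hy' : ∀ i, Tendsto (fun k => y' k i) l (𝓝 (s i)))
    (hf : ∀ i, PairTendsto l (fun k => y k i) (fun k => y' k i) (fun _ => f) (f (s i)) (m (s i))) :
    Tendsto (fun k => finsetDividedDifference (fun x => f x * q.eval x ^ 2)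
        (pairNodes (y k) (y' k) μ)) l
      (𝓝 (∑ i, ∑ j, (lagrangeCoeff q s i / (μ - s i)) * (lagrangeCoeff q s j / (μ - s j)) *
        secantGap f m μ (s i) (s j))) := by
  set c := lagrangeCoeff q s with hc
  have hμ' : ∀ i, μ - s i ≠ 0 := fun i => sub_ne_zero.2 (hμ i).symm
  have hμ'' : ∀ i, s i - μ ≠ 0 := fun i => sub_ne_zero.2 (hμ i)
  rw [sum_secantGap_eq f m hs]
  have hmain : Tendsto (fun k => f μ * q.eval μ ^ 2 / ∏ j, ((μ - y k j) * (μ - y' k j))) l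
      (𝓝 (f μ * (∑ i, c i / (μ - s i)) ^ 2)) := by
    have hp : Tendsto (fun k => ∏ j, ((μ - y k j) * (μ - y' k j))) l
        (𝓝 (∏ j, ((μ - s j) * (μ - s j)))) :=
      tendsto_finsetProd _ fun j _ =>
        (tendsto_const_nhds.sub (hy j)).mul (tendsto_const_nhds.sub (hy' j))
    have hP : ∏ j, (μ - s j) ≠ 0 := Finset.prod_ne_zero_iff.2 fun j _ => hμ' j
    have hval : q.eval μ = (∏ j, (μ - s j)) * ∑ i, c i / (μ - s i) := by
      rw [eval_eq_sum_lagrangeCoeff q hq hs, Finset.mul_sum]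
      refine Finset.sum_congr rfl fun i _ => ?_
      rw [← Finset.mul_prod_erase Finset.univ (fun j => μ - s j) (Finset.mem_univ i)]
      have := hμ' i
      rw [hc]
      field_simp
    have h := (tendsto_const_nhds (x := f μ * q.eval μ ^ 2)).div hp (by
      rw [Finset.prod_mul_distrib]; exact mul_ne_zero hP hP)
    have e : f μ * q.eval μ ^ 2 / ∏ j, ((μ - s j) * (μ - s j)) =
        f μ * (∑ i, c i / (μ - s i)) ^ 2 := by
      rw [hval, Finset.prod_mul_distrib]
      field_simp
    rw [← e]
    exact h
  have hterm : ∀ i, Tendsto (fun k => (f (y' k i) * q.eval (y' k i) ^ 2 / ((y' k i - μ) *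
        ∏ j ∈ Finset.univ.erase i, ((y' k i - y k j) * (y' k i - y' k j))) -
      f (y k i) * q.eval (y k i) ^ 2 / ((y k i - μ) *
        ∏ j ∈ Finset.univ.erase i, ((y k i - y k j) * (y k i - y' k j)))) / (y' k i - y k i)) l
      (𝓝 (-(f (s i) * ((c i / (μ - s i)) ^ 2 + 2 * (c i / (μ - s i)) *
        ∑ j ∈ Finset.univ.erase i, (c j / (μ - s j)) * (μ - s j) / (s i - s j)) +
          m (s i) * ((c i / (μ - s i)) ^ 2 * (μ - s i))))) := by
    intro i
    have hne : ∀ᶠ k in l, y k i ≠ y' k i := hdist.mono fun k hk => hk.2.2.1 i i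
    have hsub : ∀ {z : α → ℝ} {w : ℝ}, Tendsto z l (𝓝 w) →
        PairTendsto l (fun k => y k i) (fun k => y' k i) (fun k x => x - z k) (s i - w) 1 :=
      fun hz => PairTendsto.sub_param (hy i) (hy' i) hne hz
    have hsne : ∀ j ∈ Finset.univ.erase i, s i - s j ≠ 0 := fun j hj =>
      sub_ne_zero.2 fun e => Finset.ne_of_mem_erase hj (hs e).symm
    have hr := (PairTendsto.const (l := l) (y := fun k => y k i) (y' := fun k => y' k i)
      (c i)).add ((hsub (tendsto_const_nhds (x := s i))).mul
        (PairTendsto.sum (Finset.univ.erase i) fun j hj =>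
          (PairTendsto.const (c j)).mul ((hsub (tendsto_const_nhds (x := s j))).inv (hsne j hj))))
    -- The factors `x - s j` of `q` are matched with the denominators `x - y k j` and `x - y' k j`;
    -- the moving nodes of the other pairs then do not affect the limit.
    have hfac : ∀ {z : Fin n → α → ℝ}, (∀ j, Tendsto (z j) l (𝓝 (s j))) →
        ∀ j ∈ Finset.univ.erase i, PairTendsto l (fun k => y k i) (fun k => y' k i)
          (fun k x => (x - s j) * (x - z j k)⁻¹) 1 0 := by
      intro z hz j hj
      have h := (hsub (tendsto_const_nhds (x := s j))).mul ((hsub (hz j)).inv (hsne j hj))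
      have h0 := hsne j hj
      convert h using 1
      · field_simp
      · field_simp
        ring
    have hprod := PairTendsto.prod_one (Finset.univ.erase i) fun j hj => by
      simpa using (hfac (z := fun j k => y k j) hy j hj).mul (hfac (z := fun j k => y' k j) hy' j hj)
    have hall := (hf i).mul (((hr.mul hr).mul ((hsub (tendsto_const_nhds (x := μ))).inv
      (hμ'' i))).mul hprod)
    have hev : ∀ {z : α → ℝ}, Tendsto z l (𝓝 (s i)) → ∀ᶠ k in l, ∀ j, j ≠ i → z k ≠ s j := by
      intro z hz
      rw [eventually_all]
      intro j
      by_cases hj : j = i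
      · simp [hj]
      · filter_upwards [hz.eventually_ne (fun e => hj (hs e).symm)] with k hk _ using hk
    have heq : ∀ k x, (∀ j, j ≠ i → x ≠ s j) → f x * (((c i + (x - s i) *
        ∑ j ∈ Finset.univ.erase i, c j * (x - s j)⁻¹) * (c i + (x - s i) *
        ∑ j ∈ Finset.univ.erase i, c j * (x - s j)⁻¹)) * (x - μ)⁻¹ *
        ∏ j ∈ Finset.univ.erase i, ((x - s j) * (x - y k j)⁻¹ * ((x - s j) * (x - y' k j)⁻¹))) =
        f x * q.eval x ^ 2 / ((x - μ) *
          ∏ j ∈ Finset.univ.erase i, ((x - y k j) * (x - y' k j))) := by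
      intro k x hx
      rw [eval_eq_prod_erase_mul q hq hs i hx]
      simp only [Finset.prod_mul_distrib, Finset.prod_inv_distrib, ← hc]
      rw [div_eq_mul_inv, mul_inv, mul_inv]
      ring
    have hfin := hall.congr (v := fun k x => f x * q.eval x ^ 2 / ((x - μ) *
          ∏ j ∈ Finset.univ.erase i, ((x - y k j) * (x - y' k j))))
      ((hev (hy i)).mono fun k hk => heq k _ hk) ((hev (hy' i)).mono fun k hk => heq k _ hk)
    have hS : ∑ j ∈ Finset.univ.erase i, (c j / (μ - s j)) * (μ - s j) / (s i - s j) =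
        ∑ j ∈ Finset.univ.erase i, c j * (s i - s j)⁻¹ :=
      Finset.sum_congr rfl fun j _ => by rw [div_mul_cancel₀ _ (hμ' j), div_eq_mul_inv]
    have h := hfin.2.2
    rw [hS]
    simp only [sub_self, zero_mul, zero_add, add_zero, mul_zero, mul_one, one_mul] at h
    convert h using 2
    have h1 := hμ' i
    rw [show s i - μ = -(μ - s i) by ring]
    field_simp
    ring
  rw [sub_eq_add_neg, ← Finset.sum_neg_distrib]
  refine (hmain.add (tendsto_finsetSum Finset.univ fun i _ => hterm i)).congr' ?_
  filter_upwards [hdist] with k hk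
  rw [finsetDividedDifference_pairNodes _ hk]

/-! ### Lowering the order, and convexity of `f`. -/

theorem isOpen_openInterval (a b : EReal) : IsOpen (openInterval a b) :=
  (isOpen_lt continuous_const continuous_coe_real_ereal).inter
    (isOpen_lt continuous_coe_real_ereal continuous_const)

theorem ordConnected_openInterval (a b : EReal) : (openInterval a b).OrdConnected :=
  ⟨fun _ hx _ hy _ hz => ⟨hx.1.trans_le (EReal.coe_le_coe_iff.2 hz.1),
    (EReal.coe_le_coe_iff.2 hz.2).trans_lt hy.2⟩⟩

theorem convex_openInterval (a b : EReal) : Convex ℝ (openInterval a b) :=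
  (ordConnected_openInterval a b).convex

/-- Every nontrivial compact interval has a point near which `f` is bounded along infinitely many
points of the interval. -/
theorem exists_accPt_abs_le (f : ℝ → ℝ) {c d : ℝ} (hcd : c < d) :
    ∃ y ∈ Set.Icc c d, ∃ N : ℕ, AccPt y (𝓟 {z ∈ Set.Icc c d | |f z| ≤ N}) := by
  obtain ⟨N, hN⟩ : ∃ N : ℕ, {z ∈ Set.Icc c d | |f z| ≤ N}.Infinite := by
    by_contra! h
    have hcount : (Set.Icc c d).Countable := by
      refine (Set.countable_iUnion fun N : ℕ => (h N).countable).mono fun z hz => ?_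
      obtain ⟨N, hN⟩ := exists_nat_ge |f z|
      exact Set.mem_iUnion.2 ⟨N, hz, hN⟩
    exact (Cardinal.Real.Icc_countable_iff.1 hcount).not_gt hcd
  obtain ⟨y, hy, hacc⟩ := hN.exists_accPt_of_subset_isCompact isCompact_Icc (Set.sep_subset _ _)
  exact ⟨y, hy, N, hacc⟩

/-- Apply the condition to `q (X - y)` with two extra nodes `y` and `z`. The node `y` cancels one
factor `x - y`, and as `z → y` the node `z` cancels the other, leaving the divided difference of `f
q²` on `s`. -/
theorem DividedDifferenceCondition.of_succ {n : ℕ} (hn : 1 ≤ n) {a b : EReal} {f : ℝ → ℝ}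
    (h : DividedDifferenceCondition (n + 1) a b f) : DividedDifferenceCondition n a b f := by
  intro q hq s hs hsI
  obtain ⟨p, hp⟩ : (openInterval a b \ s).Nonempty := by
    obtain ⟨x, hx⟩ : s.Nonempty := Finset.card_pos.1 (by omega)
    have hinf : (openInterval a b).Infinite :=
      infinite_of_mem_nhds x ((isOpen_openInterval a b).mem_nhds (hsI x hx))
    exact (hinf.sdiff s.finite_toSet).nonempty
  have hopen : IsOpen (openInterval a b \ s) :=
    (isOpen_openInterval a b).sdiff s.finite_toSet.isClosed
  obtain ⟨ε, hε, hball⟩ := Metric.nhds_basis_closedBall.mem_iff.1 (hopen.mem_nhds hp)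
  rw [Real.closedBall_eq_Icc] at hball
  -- Nothing is known about the regularity of `f`. For the term of the node `z` to vanish in the
  -- limit, it is enough that `z → y` through points where `f` is bounded.
  obtain ⟨y, hy, N, hacc⟩ := exists_accPt_abs_le f (show p - ε < p + ε by linarith)
  set S : Set ℝ := {z ∈ Set.Icc (p - ε) (p + ε) | |f z| ≤ N} with hS
  set l : Filter ℝ := 𝓝[≠] y ⊓ 𝓟 S with hl
  have : l.NeBot := hacc
  have hly : l ≤ 𝓝 y := inf_le_left.trans inf_le_left
  have hys : y ∉ s := (hball hy).2
  set Q : Polynomial ℝ := q * (Polynomial.X - Polynomial.C y) with hQ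
  have hQdeg : Q.natDegree ≤ n + 1 - 1 := by
    refine Polynomial.natDegree_mul_le.trans ?_
    rw [Polynomial.natDegree_X_sub_C]
    omega
  have hnonneg : ∀ᶠ z in l, 0 ≤ f z * (q.eval z ^ 2 * (z - y) / ∏ r ∈ s, (z - r)) +
      ∑ r ∈ s, f r * q.eval r ^ 2 * (r - y) / ((r - z) * ∏ w ∈ s.erase r, (r - w)) := by
    have h1 : ∀ᶠ z in l, z ≠ y := mem_inf_of_left self_mem_nhdsWithin
    have h2 : ∀ᶠ z in l, z ∈ S := mem_inf_of_right (mem_principal_self S)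
    filter_upwards [h1, h2] with z hzy hzS
    have hz := hball hzS.1
    have hzs : z ∉ s := hz.2
    have hzins : z ∉ insert y s := by simp [hzy, hzs]
    have hpos := h Q hQdeg (insert z (insert y s))
      (by rw [Finset.card_insert_of_notMem hzins, Finset.card_insert_of_notMem hys, hs]; ring)
      (by
        intro w hw
        rcases Finset.mem_insert.1 hw with rfl | hw
        · exact hz.1
        rcases Finset.mem_insert.1 hw with rfl | hw
        · exact (hball hy).1
        · exact hsI w hw)
    rw [finsetDividedDifference_insert _ hzins, Finset.prod_insert hys,
      Finset.sum_insert hys] at hpos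
    have hzy' : z - y ≠ 0 := sub_ne_zero.2 hzy
    convert hpos using 1
    simp only [hQ, Polynomial.eval_mul, Polynomial.eval_sub, Polynomial.eval_X, Polynomial.eval_C,
      sub_self, mul_zero, ne_eq, OfNat.ofNat_ne_zero, not_false_eq_true, zero_pow, zero_div,
      zero_add]
    congr 1
    · rw [mul_pow, pow_two (z - y)]
      rw [show f z * (q.eval z ^ 2 * ((z - y) * (z - y))) =
        (z - y) * (f z * (q.eval z ^ 2 * (z - y))) by ring, mul_div_mul_left _ _ hzy']
      ring
    · refine Finset.sum_congr rfl fun r hr => ?_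
      have hyr : y ≠ r := fun e => hys (e ▸ hr)
      have hry : r - y ≠ 0 := sub_ne_zero.2 hyr.symm
      rw [Finset.erase_insert_of_ne hyr,
        Finset.prod_insert (fun e => hys (Finset.mem_of_mem_erase e)), mul_left_comm (r - z),
        mul_pow, show f r * (q.eval r ^ 2 * (r - y) ^ 2) =
          (r - y) * (f r * q.eval r ^ 2 * (r - y)) by ring, mul_div_mul_left _ _ hry]
  have hlim1 : Tendsto (fun z => f z * (q.eval z ^ 2 * (z - y) / ∏ r ∈ s, (z - r))) l (𝓝 0) := by
    have hc : Tendsto (fun z => q.eval z ^ 2 * (z - y) / ∏ r ∈ s, (z - r)) l (𝓝 0) := by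
      have hcont : ContinuousAt (fun z => q.eval z ^ 2 * (z - y) / ∏ r ∈ s, (z - r)) y := by
        refine ContinuousAt.div (by fun_prop) (by fun_prop) ?_
        exact Finset.prod_ne_zero_iff.2 fun r hr => sub_ne_zero.2 fun e => hys (e ▸ hr)
      have := hcont.tendsto.mono_left hly
      simpa using this
    refine bdd_le_mul_tendsto_zero' (N : ℝ) ?_ hc
    filter_upwards [mem_inf_of_right (mem_principal_self S)] with z hz using hz.2
  have hlim2 : Tendsto (fun z => ∑ r ∈ s, f r * q.eval r ^ 2 * (r - y) /
      ((r - z) * ∏ w ∈ s.erase r, (r - w))) l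
      (𝓝 (finsetDividedDifference (fun x => f x * q.eval x ^ 2) s)) := by
    refine tendsto_finsetSum _ fun r hr => ?_
    have hyr : r - y ≠ 0 := sub_ne_zero.2 fun e => hys (e ▸ hr)
    have hp : ∏ w ∈ s.erase r, (r - w) ≠ 0 :=
      Finset.prod_ne_zero_iff.2 fun w hw => sub_ne_zero.2 (Finset.ne_of_mem_erase hw).symm
    have hcont : ContinuousAt (fun z => f r * q.eval r ^ 2 * (r - y) /
        ((r - z) * ∏ w ∈ s.erase r, (r - w))) y :=
      ContinuousAt.div (by fun_prop) (by fun_prop) (mul_ne_zero hyr hp)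
    have := hcont.tendsto.mono_left hly
    convert this using 2
    rw [mul_comm _ (r - y), mul_div_mul_left _ _ hyr]
  have := ge_of_tendsto (hlim1.add hlim2) hnonneg
  rwa [zero_add] at this

/-- Descend to order 1: with `q = 1` the condition says that second divided differences are
nonnegative, that is, that adjacent slopes increase. -/
theorem DividedDifferenceCondition.convexOn {n : ℕ} (hn : 1 ≤ n) {a b : EReal} {f : ℝ → ℝ}
    (h : DividedDifferenceCondition n a b f) : ConvexOn ℝ (openInterval a b) f := by
  have h1 : DividedDifferenceCondition 1 a b f := by
    induction n, hn using Nat.le_induction with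
    | base => exact h
    | succ k hk ih => exact ih (h.of_succ hk)
  refine convexOn_of_slope_mono_adjacent (convex_openInterval a b) ?_
  intro x y z hx hz hxy hyz
  have hy : y ∈ openInterval a b := (ordConnected_openInterval a b).out hx hz ⟨hxy.le, hyz.le⟩
  have hxz := hxy.trans hyz
  have hyT : y ∉ ({z} : Finset ℝ) := by simp [hyz.ne]
  have hxT : x ∉ ({y, z} : Finset ℝ) := by simp [hxy.ne, hxz.ne]
  have hpos := h1 1 (by simp) {x, y, z} (by
    rw [Finset.card_insert_of_notMem hxT, Finset.card_insert_of_notMem hyT,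
      Finset.card_singleton]) (by
    intro w hw
    simp only [Finset.mem_insert, Finset.mem_singleton] at hw
    rcases hw with rfl | rfl | rfl <;> assumption)
  rw [finsetDividedDifference_insert _ hxT, Finset.prod_insert hyT, Finset.prod_singleton,
    Finset.sum_insert hyT, Finset.sum_singleton, Finset.erase_insert hyT,
    Finset.erase_insert_of_ne hyz.ne, Finset.erase_singleton, Finset.prod_singleton] at hpos
  simp only [Polynomial.eval_one, one_pow, mul_one, insert_empty_eq, Finset.prod_singleton] at hpos
  have e1 : 0 < y - x := sub_pos.2 hxy
  have e2 : 0 < z - y := sub_pos.2 hyz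
  have e3 : 0 < z - x := sub_pos.2 hxz
  have key : (z - x) * (f x / ((x - y) * (x - z)) + (f y / ((y - x) * (y - z)) +
      f z / ((z - x) * (z - y)))) = (f z - f y) / (z - y) - (f y - f x) / (y - x) := by
    rw [show x - y = -(y - x) by ring, show x - z = -(z - x) by ring,
      show y - z = -(z - y) by ring]
    field_simp
    ring
  have := mul_nonneg e3.le hpos
  rw [key] at this
  linarith

/-! ### Positivity of secant gap forms from the divided difference condition. -/

/-- Right derivatives of a convex function are limits of difference quotients in the sense of
`PairTendsto`. -/
theorem ConvexOn.pairTendsto_rightDeriv {S : Set ℝ} {f : ℝ → ℝ} (hS : IsOpen S)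
    (hf : ConvexOn ℝ S f) {x : ℝ} (hx : x ∈ S) :
    PairTendsto (𝓝[>] (0 : ℝ)) (fun _ => x) (fun δ => x + δ) (fun _ => f) (f x)
      (derivWithin f (Set.Ioi x) x) := by
  have hxi : x ∈ interior S := by rwa [hS.interior_eq]
  have hd := hf.hasDerivWithinAt_rightDeriv_of_mem_interior hxi
  have hmap : Tendsto (fun δ : ℝ => x + δ) (𝓝[>] 0) (𝓝[>] x) := by
    refine tendsto_nhdsWithin_iff.2 ⟨?_, ?_⟩
    · have : Tendsto (fun δ : ℝ => x + δ) (𝓝 0) (𝓝 (x + 0)) :=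
        (continuous_const.add continuous_id).tendsto 0
      rw [add_zero] at this
      exact this.mono_left nhdsWithin_le_nhds
    · filter_upwards [self_mem_nhdsWithin] with δ hδ
      exact lt_add_of_pos_right x hδ
  refine ⟨tendsto_const_nhds, hd.continuousWithinAt.tendsto.comp hmap, ?_⟩
  have := (hasDerivWithinAt_iff_tendsto_slope' (by simp)).1 hd
  refine (this.comp hmap).congr fun δ => ?_
  simp [slope_def_field]

/-- The polynomial with prescribed coefficients in the basis `∏ j ≠ i, (X - s j)`. -/
noncomputable def ofLagrangeCoeff {n : ℕ} (s c : Fin n → ℝ) : Polynomial ℝ :=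
  ∑ i, Polynomial.C (c i) * ∏ j ∈ Finset.univ.erase i, (Polynomial.X - Polynomial.C (s j))

theorem natDegree_ofLagrangeCoeff_le {n : ℕ} (s c : Fin n → ℝ) :
    (ofLagrangeCoeff s c).natDegree ≤ n - 1 := by
  refine Polynomial.natDegree_sum_le_of_forall_le _ _ fun i _ => ?_
  refine (Polynomial.natDegree_C_mul_le _ _).trans ?_
  rw [Polynomial.natDegree_prod_of_monic _ _ fun j _ => Polynomial.monic_X_sub_C _]
  simp

theorem lagrangeCoeff_ofLagrangeCoeff {n : ℕ} {s : Fin n → ℝ} (hs : Function.Injective s)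
    (c : Fin n → ℝ) (i : Fin n) : lagrangeCoeff (ofLagrangeCoeff s c) s i = c i := by
  have hp : ∏ j ∈ Finset.univ.erase i, (s i - s j) ≠ 0 :=
    Finset.prod_ne_zero_iff.2 fun j hj =>
      sub_ne_zero.2 fun e => Finset.ne_of_mem_erase hj (hs e).symm
  rw [lagrangeCoeff, div_eq_iff hp, ofLagrangeCoeff, Polynomial.eval_finsetSum]
  simp only [Polynomial.eval_mul, Polynomial.eval_C, Polynomial.eval_prod, Polynomial.eval_sub,
    Polynomial.eval_X]
  refine Finset.sum_eq_single i (fun k _ hk => ?_) (by simp)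
  rw [Finset.prod_eq_zero (Finset.mem_erase.2 ⟨hk.symm, Finset.mem_univ i⟩) (sub_self _), mul_zero]

theorem degree_lt_of_natDegree_le_pred {q : Polynomial ℝ} {n : ℕ} (hn : 1 ≤ n)
    (hq : q.natDegree ≤ n - 1) : q.degree < n :=
  Polynomial.degree_le_natDegree.trans_lt (by exact_mod_cast (by omega : q.natDegree < n))

theorem DividedDifferenceCondition.sum_secantGap_nonneg_of_injective {n : ℕ} (hn : 1 ≤ n)
    {a b : EReal} {f : ℝ → ℝ} (h : DividedDifferenceCondition n a b f)
    {s : Fin n → ℝ} (hs : Function.Injective s) (hsI : ∀ i, s i ∈ openInterval a b)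
    {μ : ℝ} (hμI : μ ∈ openInterval a b) (hμ : ∀ i, s i ≠ μ) (d : Fin n → ℝ) :
    0 ≤ ∑ i, ∑ j, d i * d j *
      secantGap f (fun x => derivWithin f (Set.Ioi x) x) μ (s i) (s j) := by
  have hconv := h.convexOn hn
  -- The limit has coefficients `lagrangeCoeff q s i / (μ - s i)`; this `q` makes them equal to `d
  -- i`.
  set q := ofLagrangeCoeff s fun i => d i * (μ - s i) with hq
  have hμ' : ∀ i, μ - s i ≠ 0 := fun i => sub_ne_zero.2 (hμ i).symm
  have hcoeff : ∀ i, lagrangeCoeff q s i / (μ - s i) = d i := fun i => by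
    rw [hq, lagrangeCoeff_ofLagrangeCoeff hs, mul_div_cancel_right₀ _ (hμ' i)]
  have hqdeg : q.natDegree ≤ n - 1 := natDegree_ofLagrangeCoeff_le _ _
  have hlim : ∀ i, Tendsto (fun δ : ℝ => s i + δ) (𝓝[>] 0) (𝓝 (s i)) := fun i => by
    have : Tendsto (fun δ : ℝ => s i + δ) (𝓝 0) (𝓝 (s i + 0)) :=
      (continuous_const.add continuous_id).tendsto 0
    rw [add_zero] at this
    exact this.mono_left nhdsWithin_le_nhds
  have hdist : ∀ᶠ δ in 𝓝[>] (0 : ℝ), PairsDistinct s (fun i => s i + δ) μ := by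
    have h1 : ∀ᶠ δ in 𝓝[>] (0 : ℝ), ∀ i j, s i ≠ s j + δ := by
      rw [eventually_all]
      intro i
      rw [eventually_all]
      intro j
      by_cases hij : i = j
      · subst hij
        filter_upwards [self_mem_nhdsWithin] with δ hδ
        exact (lt_add_of_pos_right (s i) hδ).ne
      · filter_upwards [(hlim j).eventually_ne (fun e => hij (hs e).symm)] with δ hδ
        exact hδ.symm
    have h2 : ∀ᶠ δ in 𝓝[>] (0 : ℝ), ∀ i, s i + δ ≠ μ :=
      eventually_all.2 fun i => (hlim i).eventually_ne (hμ i)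
    filter_upwards [h1, h2] with δ h1 h2
    exact ⟨hs, fun i j e => hs (add_right_cancel e), h1, hμ, h2⟩
  have ht := tendsto_finsetDividedDifference_pairNodes (l := 𝓝[>] (0 : ℝ)) (y := fun _ => s)
    (y' := fun δ i => s i + δ) (s := s) (μ := μ) (f := f)
    (m := fun x => derivWithin f (Set.Ioi x) x) (degree_lt_of_natDegree_le_pred hn hqdeg) hs hμ hdist
    (fun i => tendsto_const_nhds) hlim
    (fun i => hconv.pairTendsto_rightDeriv (isOpen_openInterval a b) (hsI i))
  simp only [hcoeff] at ht
  refine ge_of_tendsto ht ?_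
  have hI : ∀ᶠ δ in 𝓝[>] (0 : ℝ), ∀ i, s i + δ ∈ openInterval a b :=
    eventually_all.2 fun i => (hlim i).eventually_mem ((isOpen_openInterval a b).mem_nhds (hsI i))
  filter_upwards [hdist, hI] with δ hδ hδI
  refine h q hqdeg _ (card_pairNodes hδ) fun w hw => ?_
  simp only [pairNodes, Finset.mem_insert, Finset.mem_union, Finset.mem_image, Finset.mem_univ,
    true_and] at hw
  rcases hw with rfl | ⟨i, rfl⟩ | ⟨i, rfl⟩
  · exact hμI
  · exact hsI i
  · exact hδI i

/-- A tuple of points of an infinite set avoiding `μ` extends, after removal of `μ` and of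
repetitions, to an injective tuple of the same length. -/
theorem exists_injective_tuple {n : ℕ} {I : Set ℝ} (hI : I.Infinite) (μ : ℝ) (t : Fin n → ℝ)
    (ht : ∀ i, t i ∈ I) :
    ∃ s : Fin n → ℝ, Function.Injective s ∧ (∀ i, s i ∈ I) ∧ (∀ i, s i ≠ μ) ∧
      ∀ i, t i ≠ μ → ∃ j, s j = t i := by
  set A : Finset ℝ := (Finset.univ.image t).erase μ with hA
  have hAcard : A.card ≤ n :=
    (Finset.card_le_card (Finset.erase_subset _ _)).trans
      (Finset.card_image_le.trans (by simp))
  have hinf : (I \ {μ}).Infinite := hI.sdiff (Set.finite_singleton μ)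
  have hAsub : (A : Set ℝ) ⊆ I \ {μ} := by
    intro x hx
    simp only [hA, Finset.coe_erase, Finset.coe_image, Finset.coe_univ, Set.image_univ] at hx
    obtain ⟨⟨i, rfl⟩, hne⟩ := hx
    exact ⟨ht i, hne⟩
  obtain ⟨D, hDI, hDcard⟩ := (hinf.sdiff A.finite_toSet).exists_subset_card_eq (n - A.card)
  obtain ⟨B, hAB, hBI, hBcard⟩ : ∃ B : Finset ℝ, A ⊆ B ∧ (B : Set ℝ) ⊆ I \ {μ} ∧ B.card = n := by
    refine ⟨A ∪ D, Finset.subset_union_left, ?_, ?_⟩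
    · rw [Finset.coe_union]
      exact Set.union_subset hAsub fun x hx => (hDI hx).1
    · rw [Finset.card_union_of_disjoint, hDcard]
      · omega
      · exact Finset.disjoint_right.2 fun x hx => (hDI hx).2
  refine ⟨fun i => B.orderEmbOfFin hBcard i, (B.orderEmbOfFin hBcard).injective,
    fun i => (hBI (B.orderEmbOfFin_mem hBcard i)).1, fun i => (hBI (B.orderEmbOfFin_mem hBcard i)).2,
    fun i hi => ?_⟩
  have : t i ∈ B := hAB (Finset.mem_erase.2 ⟨hi, Finset.mem_image_of_mem t (Finset.mem_univ i)⟩)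
  rw [← Finset.mem_coe, ← Finset.range_orderEmbOfFin B hBcard] at this
  exact this

/-- Eigenvalues may be repeated or equal to `μ`. Repeated nodes are merged by adding their weights,
nodes at `μ` contribute nothing because their gaps vanish, and padding nodes get weight zero. -/
theorem DividedDifferenceCondition.sum_secantGap_nonneg {n : ℕ} (hn : 1 ≤ n)
    {a b : EReal} {f : ℝ → ℝ} (h : DividedDifferenceCondition n a b f)
    {t : Fin n → ℝ} (htI : ∀ i, t i ∈ openInterval a b)
    {μ : ℝ} (hμI : μ ∈ openInterval a b) (d : Fin n → ℝ) :
    0 ≤ ∑ i, ∑ j, d i * d j *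
      secantGap f (fun x => derivWithin f (Set.Ioi x) x) μ (t i) (t j) := by
  set m : ℝ → ℝ := fun x => derivWithin f (Set.Ioi x) x
  have hinf : (openInterval a b).Infinite :=
    infinite_of_mem_nhds μ ((isOpen_openInterval a b).mem_nhds hμI)
  obtain ⟨s, hs, hsI, hsμ, hst⟩ := exists_injective_tuple hinf μ t htI
  have hpos := h.sum_secantGap_nonneg_of_injective hn hs hsI hμI hsμ
    fun k => ∑ i, if t i = s k then d i else 0
  refine hpos.trans_eq ?_
  have hinner : ∀ i j, ∑ k, ∑ l, (if t i = s k then d i else 0) * (if t j = s l then d j else 0) *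
      secantGap f m μ (s k) (s l) = d i * d j * secantGap f m μ (t i) (t j) := by
    intro i j
    by_cases hi : t i = μ
    · rw [hi, secantGap_self_left, mul_zero]
      refine Finset.sum_eq_zero fun k _ => Finset.sum_eq_zero fun l _ => ?_
      rw [if_neg (fun e => hsμ k e.symm), zero_mul, zero_mul]
    by_cases hj : t j = μ
    · rw [hj, secantGap_self_right, mul_zero]
      refine Finset.sum_eq_zero fun k _ => Finset.sum_eq_zero fun l _ => ?_
      rw [if_neg (c := μ = s l) (fun e => hsμ l e.symm), mul_zero, zero_mul]
    obtain ⟨k, hk⟩ := hst i hi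
    obtain ⟨l, hl⟩ := hst j hj
    rw [Finset.sum_eq_single k, Finset.sum_eq_single l, if_pos hk.symm, if_pos hl.symm, hk, hl]
    · intro l' _ hl'
      rw [if_neg (c := t j = s l') (fun e => hl' (hs (hl.trans e)).symm), mul_zero, zero_mul]
    · simp
    · intro k' _ hk'
      refine Finset.sum_eq_zero fun l' _ => ?_
      rw [if_neg (fun e => hk' (hs (hk.trans e)).symm), zero_mul, zero_mul]
    · simp
  have e : ∀ F : Fin n → Fin n → Fin n → Fin n → ℝ,
      ∑ k, ∑ l, ∑ i, ∑ j, F i j k l = ∑ i, ∑ j, ∑ k, ∑ l, F i j k l := by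
    intro F
    calc ∑ k, ∑ l, ∑ i, ∑ j, F i j k l = ∑ k, ∑ i, ∑ l, ∑ j, F i j k l :=
          Finset.sum_congr rfl fun k _ => Finset.sum_comm
      _ = ∑ i, ∑ k, ∑ l, ∑ j, F i j k l := Finset.sum_comm
      _ = ∑ i, ∑ k, ∑ j, ∑ l, F i j k l :=
          Finset.sum_congr rfl fun i _ => Finset.sum_congr rfl fun k _ => Finset.sum_comm
      _ = ∑ i, ∑ j, ∑ k, ∑ l, F i j k l := Finset.sum_congr rfl fun i _ => Finset.sum_comm
  calc _ = ∑ k, ∑ l, ∑ i, ∑ j, (if t i = s k then d i else 0) * (if t j = s l then d j else 0) *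
        secantGap f m μ (s k) (s l) := by
        refine Finset.sum_congr rfl fun k _ => Finset.sum_congr rfl fun l _ => ?_
        rw [Finset.sum_mul_sum, Finset.sum_mul]
        exact Finset.sum_congr rfl fun i _ => Finset.sum_mul _ _ _
    _ = _ := (e _).trans
      (Finset.sum_congr rfl fun i _ => Finset.sum_congr rfl fun j _ => hinner i j)

/-! ### Spectral calculus and the exact first-order expansion. -/

open Matrix in
/-- The Hermitian matrix with eigenvalues `μ` and eigenvectors the columns of `U`. -/
noncomputable def spectralMatrix {n : ℕ} (U : Matrix (Fin n) (Fin n) ℂ) (μ : Fin n → ℝ) :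
    Matrix (Fin n) (Fin n) ℂ :=
  U * diagonal (fun i => (μ i : ℂ)) * Uᴴ

section Spectral

open Matrix

variable {n : ℕ}

theorem isHermitian_spectralMatrix (U : Matrix (Fin n) (Fin n) ℂ) (μ : Fin n → ℝ) :
    (spectralMatrix U μ).IsHermitian := by
  unfold spectralMatrix
  apply isHermitian_mul_mul_conjTranspose
  exact isHermitian_diagonal_of_self_adjoint _ (funext fun i => Complex.conj_ofReal _)

theorem exists_eq_spectralMatrix {M : Matrix (Fin n) (Fin n) ℂ} (hM : M.IsHermitian) :
    ∃ U : Matrix (Fin n) (Fin n) ℂ, ∃ μ : Fin n → ℝ, Uᴴ * U = 1 ∧ U * Uᴴ = 1 ∧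
      (∀ i, μ i ∈ spectrum ℝ M) ∧ spectrum ℝ M = Set.range μ ∧ M = spectralMatrix U μ ∧
        ∀ f : ℝ → ℝ, cfc f M = spectralMatrix U (f ∘ μ) := by
  refine ⟨hM.eigenvectorUnitary, hM.eigenvalues, ?_, ?_, hM.eigenvalues_mem_spectrum_real,
    hM.spectrum_real_eq_range_eigenvalues, ?_, ?_⟩
  · exact Unitary.coe_star_mul_self _
  · exact Unitary.coe_mul_star_self _
  · conv_lhs => rw [hM.spectral_theorem]
    rfl
  · intro f
    rw [hM.cfc_eq]
    rfl

/-- Eigenvectors for different eigenvalues are orthogonal. So `Wᴴ * U` also intertwines `f ∘ ν` and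
`f ∘ μ`, and `f(A)` does not depend on the diagonalization. -/
theorem intertwine_of_spectralMatrix_eq {U W : Matrix (Fin n) (Fin n) ℂ} {μ ν : Fin n → ℝ}
    (hU : Uᴴ * U = 1) (hW : Wᴴ * W = 1) (h : spectralMatrix U μ = spectralMatrix W ν)
    (i j : Fin n) (hij : (Wᴴ * U) i j ≠ 0) : ν i = μ j := by
  have e : diagonal (fun i => (ν i : ℂ)) * (Wᴴ * U) = (Wᴴ * U) * diagonal (fun i => (μ i : ℂ)) := by
    have h1 : Wᴴ * spectralMatrix W ν * U = diagonal (fun i => (ν i : ℂ)) * (Wᴴ * U) := by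
      simp only [spectralMatrix, ← mul_assoc, hW, one_mul]
    have h2 : Wᴴ * spectralMatrix U μ * U = (Wᴴ * U) * diagonal (fun i => (μ i : ℂ)) := by
      simp only [spectralMatrix, mul_assoc, hU, mul_one]
    rw [← h1, ← h2, h]
  have e' := congrFun (congrFun e i) j
  rw [diagonal_mul, mul_diagonal, mul_comm] at e'
  exact_mod_cast mul_left_cancel₀ hij e'

theorem spectrum_spectralMatrix_subset {U : Matrix (Fin n) (Fin n) ℂ} {μ : Fin n → ℝ}
    (hU : Uᴴ * U = 1) (hU' : U * Uᴴ = 1) : spectrum ℝ (spectralMatrix U μ) ⊆ Set.range μ := by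
  obtain ⟨W, ν, hW, hW', -, hs, h, -⟩ :=
    exists_eq_spectralMatrix (isHermitian_spectralMatrix U μ)
  rw [hs]
  rintro _ ⟨i, rfl⟩
  by_contra hne
  have hzero : ∀ j, (Wᴴ * U) i j = 0 := fun j => by
    by_contra hj
    exact hne ⟨j, (intertwine_of_spectralMatrix_eq hU hW h i j hj).symm⟩
  have hone : (Wᴴ * U) * (Wᴴ * U)ᴴ = 1 := by
    rw [conjTranspose_mul, conjTranspose_conjTranspose, mul_assoc, ← mul_assoc U, hU', one_mul, hW]
  have := congrFun (congrFun hone i) i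
  rw [mul_apply] at this
  simp [hzero] at this

theorem cfc_spectralMatrix {U : Matrix (Fin n) (Fin n) ℂ} {μ : Fin n → ℝ}
    (hU : Uᴴ * U = 1) (hU' : U * Uᴴ = 1) (f : ℝ → ℝ) :
    cfc f (spectralMatrix U μ) = spectralMatrix U (f ∘ μ) := by
  obtain ⟨W, ν, hW, hW', -, -, h, hf⟩ := exists_eq_spectralMatrix (isHermitian_spectralMatrix U μ)
  rw [hf]
  have e : diagonal (fun i => ((f ∘ ν) i : ℂ)) * (Wᴴ * U) =
      (Wᴴ * U) * diagonal (fun i => ((f ∘ μ) i : ℂ)) := by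
    ext i j
    rw [diagonal_mul, mul_diagonal]
    by_cases hij : (Wᴴ * U) i j = 0
    · rw [hij, mul_zero, zero_mul]
    · simp only [Function.comp_apply]
      rw [intertwine_of_spectralMatrix_eq hU hW h i j hij, mul_comm]
  calc spectralMatrix W (f ∘ ν)
      = W * (diagonal (fun i => ((f ∘ ν) i : ℂ)) * (Wᴴ * U)) * Uᴴ := by
        simp only [spectralMatrix, mul_assoc, hU', mul_one]
    _ = (W * Wᴴ) * spectralMatrix U (f ∘ μ) := by
        rw [e]; simp only [spectralMatrix, mul_assoc]
    _ = spectralMatrix U (f ∘ μ) := by rw [hW', one_mul]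

theorem dotProduct_spectralMatrix_mulVec (U : Matrix (Fin n) (Fin n) ℂ) (μ : Fin n → ℝ)
    (v : Fin n → ℂ) :
    star v ⬝ᵥ (spectralMatrix U μ *ᵥ v) =
      ∑ k, (μ k : ℂ) * (star ((Uᴴ *ᵥ v) k) * (Uᴴ *ᵥ v) k) := by
  rw [spectralMatrix, ← mulVec_mulVec, ← mulVec_mulVec, dotProduct_mulVec]
  have : star v ᵥ* U = star (Uᴴ *ᵥ v) := by
    rw [star_mulVec, conjTranspose_conjTranspose]
  rw [this, dotProduct]
  refine Finset.sum_congr rfl fun k _ => ?_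
  rw [mulVec_diagonal, Pi.star_apply]
  ring

/-- The Hermitian form by which `f` exceeds its first-order approximation: the sum over the
eigenvalues `μ k` of the forms with coefficients `secantGap f m (μ k) (lam i) (lam l)`. -/
noncomputable def gapForm (f m : ℝ → ℝ) (lam μ : Fin n → ℝ) (P : Matrix (Fin n) (Fin n) ℂ)
    (w : Fin n → ℂ) : ℂ :=
  ∑ k, ∑ i, ∑ l, star (P k i * w i) * (P k l * w l) * (secantGap f m (μ k) (lam i) (lam l) : ℂ)

/-- The first-order term, as a linear functional of a matrix. -/
noncomputable def slopeForm (f m : ℝ → ℝ) (lam : Fin n → ℝ) (w : Fin n → ℂ)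
    (N : Matrix (Fin n) (Fin n) ℂ) : ℂ :=
  ∑ i, ∑ l, star (w i) * w l * (secantSlope f m (lam i) (lam l) : ℂ) * N i l

/-- Expand each gap as `f (μ k)`, minus a part free of `μ k`, minus slope times `μ k`. Summed over
`k`, orthonormality of the columns of `P` leaves only the diagonal of the middle part, and the last
part becomes the slope form of `Pᴴ diag(μ) P`. -/
theorem sum_eq_add_slopeForm_add_gapForm (f m : ℝ → ℝ) (lam μ : Fin n → ℝ)
    {P : Matrix (Fin n) (Fin n) ℂ} (hP : Pᴴ * P = 1) (w : Fin n → ℂ) :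
    ∑ k, (f (μ k) : ℂ) * (star ((P *ᵥ w) k) * (P *ᵥ w) k) =
      ∑ i, (f (lam i) : ℂ) * (star (w i) * w i) +
        (slopeForm f m lam w (Pᴴ * diagonal (fun k => (μ k : ℂ)) * P) -
          slopeForm f m lam w (diagonal fun i => (lam i : ℂ))) + gapForm f m lam μ P w := by
  have hgap : gapForm f m lam μ P w =
      ∑ k, ∑ i, ∑ l, star (P k i * w i) * (P k l * w l) * (f (μ k) : ℂ) -
      ∑ k, ∑ i, ∑ l, (star (P k i) * P k l) * (star (w i) * w l * ((f (lam i) : ℂ) -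
        secantSlope f m (lam i) (lam l) * lam i)) -
      ∑ k, ∑ i, ∑ l, star (w i) * w l * (secantSlope f m (lam i) (lam l) : ℂ) *
        (star (P k i) * μ k * P k l) := by
    simp only [gapForm, ← Finset.sum_sub_distrib]
    refine Finset.sum_congr rfl fun k _ => Finset.sum_congr rfl fun i _ =>
      Finset.sum_congr rfl fun l _ => ?_
    simp only [secantGap, star_mul]
    push_cast
    ring
  have h1 : ∑ k, ∑ i, ∑ l, star (P k i * w i) * (P k l * w l) * (f (μ k) : ℂ) =
      ∑ k, (f (μ k) : ℂ) * (star ((P *ᵥ w) k) * (P *ᵥ w) k) := by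
    refine Finset.sum_congr rfl fun k _ => ?_
    rw [mulVec, dotProduct, star_sum, Finset.sum_mul_sum, Finset.mul_sum]
    refine Finset.sum_congr rfl fun i _ => ?_
    rw [Finset.mul_sum]
    exact Finset.sum_congr rfl fun l _ => by ring
  have h3 : ∑ k, ∑ i, ∑ l, star (w i) * w l * (secantSlope f m (lam i) (lam l) : ℂ) *
        (star (P k i) * μ k * P k l) =
      slopeForm f m lam w (Pᴴ * diagonal (fun k => (μ k : ℂ)) * P) := by
    rw [slopeForm, Finset.sum_comm]
    refine Finset.sum_congr rfl fun i _ => ?_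
    rw [Finset.sum_comm]
    refine Finset.sum_congr rfl fun l _ => ?_
    rw [← Finset.mul_sum, mul_apply]
    congr 1
    exact Finset.sum_congr rfl fun k _ => by rw [mul_diagonal, conjTranspose_apply]
  have h2 : ∑ k, ∑ i, ∑ l, (star (P k i) * P k l) * (star (w i) * w l * ((f (lam i) : ℂ) -
        secantSlope f m (lam i) (lam l) * lam i)) =
      ∑ i, (f (lam i) : ℂ) * (star (w i) * w i) -
        slopeForm f m lam w (diagonal fun i => (lam i : ℂ)) := by
    rw [Finset.sum_comm, slopeForm, ← Finset.sum_sub_distrib]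
    refine Finset.sum_congr rfl fun i _ => ?_
    rw [Finset.sum_comm]
    have hδ : ∀ l, ∑ k, star (P k i) * P k l = if i = l then 1 else 0 := by
      intro l
      have := congrFun (congrFun hP i) l
      rw [mul_apply, one_apply] at this
      simpa [conjTranspose_apply] using this
    have e : ∀ l, ∑ k, (star (P k i) * P k l) * (star (w i) * w l * ((f (lam i) : ℂ) -
        secantSlope f m (lam i) (lam l) * lam i)) = if i = l then
          (star (w i) * w l * ((f (lam i) : ℂ) - secantSlope f m (lam i) (lam l) * lam i))
            else 0 := by
      intro l
      rw [← Finset.sum_mul, hδ]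
      split_ifs <;> simp
    have e' : ∀ l, star (w i) * w l * (secantSlope f m (lam i) (lam l) : ℂ) *
        (diagonal fun i => (lam i : ℂ)) i l = if i = l then
          star (w i) * w l * (secantSlope f m (lam i) (lam l) : ℂ) * lam i else 0 := by
      intro l
      rw [diagonal_apply]
      split_ifs <;> simp
    simp only [e, e', Finset.sum_ite_eq, Finset.mem_univ, if_true]
    ring
  rw [hgap, h1, h2, h3]
  ring

/-- The quadratic form of `f (M)` is that of `f (C)` plus a linear functional of `M - C` plus
a remainder. -/
theorem dotProduct_spectralMatrix_eq (f m : ℝ → ℝ) {lam μ : Fin n → ℝ}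
    {U V : Matrix (Fin n) (Fin n) ℂ} (hU' : U * Uᴴ = 1) (hV : Vᴴ * V = 1) (hV' : V * Vᴴ = 1)
    (v : Fin n → ℂ) :
    star v ⬝ᵥ (spectralMatrix U (f ∘ μ) *ᵥ v) = star v ⬝ᵥ (spectralMatrix V (f ∘ lam) *ᵥ v) +
      (slopeForm f m lam (Vᴴ *ᵥ v) (Vᴴ * spectralMatrix U μ * V) -
        slopeForm f m lam (Vᴴ *ᵥ v) (Vᴴ * spectralMatrix V lam * V)) +
      gapForm f m lam μ (Uᴴ * V) (Vᴴ *ᵥ v) := by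
  have hP : (Uᴴ * V)ᴴ * (Uᴴ * V) = 1 := by
    rw [conjTranspose_mul, conjTranspose_conjTranspose, mul_assoc, ← mul_assoc U, hU', one_mul, hV]
  have h := sum_eq_add_slopeForm_add_gapForm f m lam μ hP (Vᴴ *ᵥ v)
  have e1 : (Uᴴ * V) *ᵥ (Vᴴ *ᵥ v) = Uᴴ *ᵥ v := by
    rw [mulVec_mulVec, mul_assoc, hV', mul_one]
  have e2 : (Uᴴ * V)ᴴ * diagonal (fun k => (μ k : ℂ)) * (Uᴴ * V) = Vᴴ * spectralMatrix U μ * V := by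
    rw [conjTranspose_mul, conjTranspose_conjTranspose]
    simp only [spectralMatrix, mul_assoc]
  have e3 : Vᴴ * spectralMatrix V lam * V = diagonal fun i => (lam i : ℂ) := by
    simp only [spectralMatrix, mul_assoc, hV, mul_one]
    rw [← mul_assoc, hV, one_mul]
  rw [dotProduct_spectralMatrix_mulVec, dotProduct_spectralMatrix_mulVec, e3, ← e2, ← e1]
  exact h

theorem slopeForm_add (f m : ℝ → ℝ) (lam : Fin n → ℝ) (w : Fin n → ℂ)
    (M N : Matrix (Fin n) (Fin n) ℂ) :
    slopeForm f m lam w (M + N) = slopeForm f m lam w M + slopeForm f m lam w N := by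
  simp only [slopeForm, Matrix.add_apply, mul_add, Finset.sum_add_distrib]

theorem slopeForm_smul (f m : ℝ → ℝ) (lam : Fin n → ℝ) (w : Fin n → ℂ) (t : ℝ)
    (M : Matrix (Fin n) (Fin n) ℂ) :
    slopeForm f m lam w (t • M) = (t : ℂ) * slopeForm f m lam w M := by
  simp only [slopeForm, Matrix.smul_apply, Finset.mul_sum, Complex.real_smul]
  exact Finset.sum_congr rfl fun i _ => Finset.sum_congr rfl fun l _ => by ring

theorem re_sum_nonneg_of_real {K : Fin n → Fin n → ℝ}
    (hK : ∀ d : Fin n → ℝ, 0 ≤ ∑ i, ∑ l, d i * d l * K i l) (z : Fin n → ℂ) :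
    0 ≤ (∑ i, ∑ l, star (z i) * z l * (K i l : ℂ)).re := by
  have : (∑ i, ∑ l, star (z i) * z l * (K i l : ℂ)).re =
      ∑ i, ∑ l, (z i).re * (z l).re * K i l + ∑ i, ∑ l, (z i).im * (z l).im * K i l := by
    rw [Complex.re_sum, ← Finset.sum_add_distrib]
    refine Finset.sum_congr rfl fun i _ => ?_
    rw [Complex.re_sum, ← Finset.sum_add_distrib]
    refine Finset.sum_congr rfl fun l _ => ?_
    simp [Complex.mul_re]
    ring
  rw [this]
  exact add_nonneg (hK _) (hK _)

theorem matrix_le_of_re_dotProduct {M N : Matrix (Fin n) (Fin n) ℂ} (hM : M.IsHermitian)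
    (hN : N.IsHermitian)
    (h : ∀ v : Fin n → ℂ, (star v ⬝ᵥ (M *ᵥ v)).re ≤ (star v ⬝ᵥ (N *ᵥ v)).re) : M ≤ N := by
  rw [Matrix.le_iff]
  refine PosSemidef.of_dotProduct_mulVec_nonneg (hN.sub hM) fun v => ?_
  rw [Complex.le_def]
  refine ⟨?_, ((hN.sub hM).im_star_dotProduct_mulVec_self v).symm⟩
  rw [sub_mulVec, dotProduct_sub, Complex.sub_re, Complex.zero_re]
  linarith [h v]

theorem isHermitian_real_combination {A B : Matrix (Fin n) (Fin n) ℂ} (hA : A.IsHermitian)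
    (hB : B.IsHermitian) (s t : ℝ) : (s • A + t • B).IsHermitian :=
  (hA.smul (IsSelfAdjoint.all s)).add (hB.smul (IsSelfAdjoint.all t))

theorem re_dotProduct_combination (A B : Matrix (Fin n) (Fin n) ℂ) (s t : ℝ) (v : Fin n → ℂ) :
    star v ⬝ᵥ ((s • A + t • B) *ᵥ v) =
      (s : ℂ) * (star v ⬝ᵥ (A *ᵥ v)) + (t : ℂ) * (star v ⬝ᵥ (B *ᵥ v)) := by
  rw [add_mulVec, dotProduct_add, smul_mulVec, smul_mulVec, dotProduct_smul, dotProduct_smul,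
    Complex.real_smul, Complex.real_smul]

end Spectral

/-! ### From divided differences to matrix convexity. -/

section Converse

open Matrix

variable {n : ℕ}

theorem sum_star_mul_mulVec {P : Matrix (Fin n) (Fin n) ℂ} (hP : Pᴴ * P = 1) (w : Fin n → ℂ) :
    ∑ k, star ((P *ᵥ w) k) * (P *ᵥ w) k = ∑ k, star (w k) * w k := by
  have : star (P *ᵥ w) ⬝ᵥ (P *ᵥ w) = star w ⬝ᵥ w := by
    rw [star_mulVec, dotProduct_mulVec, vecMul_vecMul, hP, vecMul_one]
  simpa [dotProduct] using this

/-- The numerical range of a Hermitian matrix with spectrum in an interval is contained in the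
interval. -/
theorem re_dotProduct_spectralMatrix_mem {U : Matrix (Fin n) (Fin n) ℂ} {μ : Fin n → ℝ}
    {I : Set ℝ} (hI : Convex ℝ I) (hμ : ∀ i, μ i ∈ I) (hU' : U * Uᴴ = 1) {v : Fin n → ℂ}
    (hv : ∑ k, star (v k) * v k = 1) : (star v ⬝ᵥ (spectralMatrix U μ *ᵥ v)).re ∈ I := by
  rw [dotProduct_spectralMatrix_mulVec]
  have hsq : ∀ z : ℂ, star z * z = ((Complex.normSq z : ℝ) : ℂ) := fun z => by
    rw [Complex.normSq_eq_conj_mul_self]; rfl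
  have h1 := sum_star_mul_mulVec (P := Uᴴ) (by rwa [conjTranspose_conjTranspose]) v
  rw [hv] at h1
  simp only [hsq] at h1 ⊢
  have h2 : ∑ k, Complex.normSq ((Uᴴ *ᵥ v) k) = 1 := by exact_mod_cast h1
  have h3 : (∑ k, (μ k : ℂ) * ((Complex.normSq ((Uᴴ *ᵥ v) k) : ℝ) : ℂ)).re =
      ∑ k, Complex.normSq ((Uᴴ *ᵥ v) k) • μ k := by
    rw [Complex.re_sum]
    refine Finset.sum_congr rfl fun k _ => ?_
    rw [Complex.re_ofReal_mul, Complex.ofReal_re, smul_eq_mul, mul_comm]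
  rw [h3]
  exact hI.sum_mem (fun k _ => Complex.normSq_nonneg _) h2 fun k _ => hμ k

theorem spectrum_combination_subset {A B : Matrix (Fin n) (Fin n) ℂ} (hA : A.IsHermitian)
    (hB : B.IsHermitian) {I : Set ℝ} (hI : Convex ℝ I) (hAI : spectrum ℝ A ⊆ I)
    (hBI : spectrum ℝ B ⊆ I) {t : ℝ} (ht : 0 ≤ t) (ht' : t ≤ 1) :
    spectrum ℝ (t • A + (1 - t) • B) ⊆ I := by
  obtain ⟨V, lam, hV, hV', -, hs, hC, -⟩ :=
    exists_eq_spectralMatrix (isHermitian_real_combination hA hB t (1 - t))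
  obtain ⟨U, μ, hU, hU', hμ, -, hA', -⟩ := exists_eq_spectralMatrix hA
  obtain ⟨W, ν, hW, hW', hν, -, hB', -⟩ := exists_eq_spectralMatrix hB
  rw [hs]
  rintro _ ⟨i, rfl⟩
  set v : Fin n → ℂ := V *ᵥ Pi.single i 1 with hv
  have hvnorm : ∑ k, star (v k) * v k = 1 := by
    rw [hv, sum_star_mul_mulVec hV]
    simp [Pi.single_apply]
  have hlam : star v ⬝ᵥ ((t • A + (1 - t) • B) *ᵥ v) = (lam i : ℂ) := by
    rw [hC, dotProduct_spectralMatrix_mulVec, hv, mulVec_mulVec, hV, one_mulVec]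
    simp [Pi.single_apply]
  have hmem := hI
    (re_dotProduct_spectralMatrix_mem hI (fun k => hAI (hμ k)) hU' hvnorm)
    (re_dotProduct_spectralMatrix_mem hI (fun k => hBI (hν k)) hW' hvnorm) ht (sub_nonneg.2 ht')
    (by ring)
  rw [← hA', ← hB'] at hmem
  have hre := congrArg Complex.re hlam
  rw [re_dotProduct_combination, Complex.add_re, Complex.re_ofReal_mul, Complex.re_ofReal_mul,
    Complex.ofReal_re] at hre
  rw [← hre]
  exact hmem

/-- Expand `f(A)` and `f(B)` about `C = t A + (1 - t) B`. The linear terms cancel in the weighted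
sum, and what remains is a nonnegative combination of two nonnegative gap forms. -/
theorem DividedDifferenceCondition.matrixConvexOfOrder (hn : 1 ≤ n) {a b : EReal} {f : ℝ → ℝ}
    (h : DividedDifferenceCondition n a b f) : MatrixConvexOfOrder n a b f := by
  intro A B hA hB hAI hBI t ht ht'
  set m : ℝ → ℝ := fun x => derivWithin f (Set.Ioi x) x
  have hCI := spectrum_combination_subset hA hB (convex_openInterval a b) hAI hBI ht ht'
  obtain ⟨V, lam, hV, hV', hlam, -, hC, hfC⟩ :=
    exists_eq_spectralMatrix (isHermitian_real_combination hA hB t (1 - t))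
  obtain ⟨U, μ, hU, hU', hμ, -, hA', hfA⟩ := exists_eq_spectralMatrix hA
  obtain ⟨W, ν, hW, hW', hν, -, hB', hfB⟩ := exists_eq_spectralMatrix hB
  rw [hfC, hfA, hfB]
  refine matrix_le_of_re_dotProduct (isHermitian_spectralMatrix _ _)
    (isHermitian_real_combination (isHermitian_spectralMatrix _ _)
      (isHermitian_spectralMatrix _ _) _ _) fun v => ?_
  have hgap : ∀ (P : Matrix (Fin n) (Fin n) ℂ) (κ : Fin n → ℝ) (w : Fin n → ℂ),
      (∀ k, κ k ∈ openInterval a b) → 0 ≤ (gapForm f m lam κ P w).re := by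
    intro P κ w hκ
    rw [gapForm, Complex.re_sum]
    refine Finset.sum_nonneg fun k _ => ?_
    exact re_sum_nonneg_of_real (K := fun i l => secantGap f m (κ k) (lam i) (lam l))
      (fun d => h.sum_secantGap_nonneg hn (fun i => hCI (hlam i)) (hκ k) d) fun i => P k i * w i
  have gA := hgap (Uᴴ * V) μ (Vᴴ *ᵥ v) fun k => hAI (hμ k)
  have gB := hgap (Wᴴ * V) ν (Vᴴ *ᵥ v) fun k => hBI (hν k)
  have eA := dotProduct_spectralMatrix_eq f m (lam := lam) (μ := μ) hU' hV hV' v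
  have eB := dotProduct_spectralMatrix_eq f m (lam := lam) (μ := ν) hW' hV hV' v
  rw [← hA', ← hC] at eA
  rw [← hB', ← hC] at eB
  have hL : slopeForm f m lam (Vᴴ *ᵥ v) (Vᴴ * (t • A + (1 - t) • B) * V) =
      (t : ℂ) * slopeForm f m lam (Vᴴ *ᵥ v) (Vᴴ * A * V) +
        ((1 - t : ℝ) : ℂ) * slopeForm f m lam (Vᴴ *ᵥ v) (Vᴴ * B * V) := by
    rw [mul_add, add_mul, slopeForm_add, mul_smul_comm, mul_smul_comm, smul_mul_assoc,
      smul_mul_assoc, slopeForm_smul, slopeForm_smul]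
  rw [hL] at eA eB
  rw [re_dotProduct_combination, Complex.add_re, Complex.re_ofReal_mul, Complex.re_ofReal_mul]
  have eA' := congrArg Complex.re eA
  have eB' := congrArg Complex.re eB
  simp only [Complex.add_re, Complex.sub_re, Complex.re_ofReal_mul] at eA' eB'
  rw [eA', eB']
  have h1 := mul_nonneg ht gA
  have h2 := mul_nonneg (sub_nonneg.2 ht') gB
  linear_combination h1 + h2

end Converse

/-! ### From matrix convexity to nonnegative remainders. -/

section Direct

open Matrix

variable {n : ℕ}

theorem spectralMatrix_one (μ : Fin n → ℝ) :
    spectralMatrix 1 μ = diagonal fun i => (μ i : ℂ) := by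
  simp [spectralMatrix]

theorem MatrixConvexOfOrder.convexOn (hn : 1 ≤ n) {a b : EReal} {f : ℝ → ℝ}
    (h : MatrixConvexOfOrder n a b f) : ConvexOn ℝ (openInterval a b) f := by
  refine ⟨convex_openInterval a b, fun x hx y hy s t hs ht hst => ?_⟩
  have hone : (1 : Matrix (Fin n) (Fin n) ℂ)ᴴ * 1 = 1 := by simp
  have hone' : (1 : Matrix (Fin n) (Fin n) ℂ) * 1ᴴ = 1 := by simp
  have hspec : ∀ z ∈ openInterval a b,
      spectrum ℝ (spectralMatrix (1 : Matrix (Fin n) (Fin n) ℂ) fun _ => z) ⊆ openInterval a b := by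
    intro z hz w hw
    obtain ⟨i, rfl⟩ := spectrum_spectralMatrix_subset hone hone' hw
    exact hz
  have key := h (spectralMatrix 1 fun _ => x) (spectralMatrix 1 fun _ => y)
    (isHermitian_spectralMatrix _ _) (isHermitian_spectralMatrix _ _) (hspec x hx) (hspec y hy)
    s hs (by linarith)
  have e : s • spectralMatrix (1 : Matrix (Fin n) (Fin n) ℂ) (fun _ => x) +
      (1 - s) • spectralMatrix 1 (fun _ => y) = spectralMatrix 1 fun _ => s • x + t • y := by
    obtain rfl : t = 1 - s := by linarith
    simp only [spectralMatrix_one]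
    ext i j
    by_cases hij : i = j
    · subst hij
      simp
    · simp [hij]
  rw [e, cfc_spectralMatrix hone hone', cfc_spectralMatrix hone hone',
    cfc_spectralMatrix hone hone', Matrix.le_iff] at key
  have hd := key.diag_nonneg (i := (⟨0, hn⟩ : Fin n))
  simp only [spectralMatrix_one, Matrix.sub_apply, Matrix.add_apply, Matrix.smul_apply,
    diagonal_apply_eq, Function.comp_apply, Complex.real_smul] at hd
  have hr : (0 : ℝ) ≤ s * f x + (1 - s) * f y - f (s • x + t • y) := by exact_mod_cast hd
  obtain rfl : t = 1 - s := by linarith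
  simp only [smul_eq_mul] at hr ⊢
  linarith

/-- The squared norms in a row sum to 1 and are at most the norms, so the norms cannot all be below
`1 / n`. -/
theorem norm_le_one_of_mul_conjTranspose {P : Matrix (Fin n) (Fin n) ℂ} (hP : P * Pᴴ = 1)
    (j : Fin n) : (∀ i, ‖P j i‖ ≤ 1) ∧ ∃ p, 1 ≤ n * ‖P j p‖ := by
  have h1 : ∑ i, ‖P j i‖ ^ 2 = 1 := by
    have := congrFun (congrFun hP j) j
    rw [mul_apply, one_apply_eq] at this
    have e : ∀ i, P j i * Pᴴ i j = ((‖P j i‖ ^ 2 : ℝ) : ℂ) := fun i => by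
      rw [conjTranspose_apply, ← Complex.normSq_eq_norm_sq, Complex.normSq_eq_conj_mul_self,
        mul_comm]
      rfl
    simp only [e] at this
    exact_mod_cast this
  have h2 : ∀ i, ‖P j i‖ ≤ 1 := fun i => by
    have := Finset.single_le_sum (f := fun i => ‖P j i‖ ^ 2) (fun i _ => sq_nonneg _)
      (Finset.mem_univ i)
    rw [h1] at this
    exact (sq_le_one_iff₀ (norm_nonneg _)).1 this
  refine ⟨h2, ?_⟩
  by_contra! hlt
  have hsum : ∑ i, ‖P j i‖ ^ 2 < ∑ _i : Fin n, (1 / n : ℝ) := by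
    refine Finset.sum_lt_sum_of_nonempty ⟨j, Finset.mem_univ j⟩ fun i _ => ?_
    have hn : (0 : ℝ) < n := by exact_mod_cast j.pos
    rw [lt_div_iff₀ hn]
    nlinarith [hlt i, h2 i, norm_nonneg (P j i), mul_nonneg hn.le (norm_nonneg (P j i))]
  have hn : (n : ℝ) ≠ 0 := by exact_mod_cast j.pos.ne'
  rw [h1, Finset.sum_const, Finset.card_univ, Fintype.card_fin, nsmul_eq_mul,
    mul_one_div_cancel hn] at hsum
  exact lt_irrefl _ hsum

/-- The `(p, p)` term is nonnegative. A cross term with `p` has one small coordinate and one small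
entry of `K`; any other term has two small coordinates. All the possibly negative terms are thus of
order `ε²`. -/
theorem re_sum_ge_of_concentrated {z : Fin n → ℂ} {K : Fin n → Fin n → ℝ} {p : Fin n}
    {ε A B C W : ℝ} (hε : 0 ≤ ε) (hA : 0 ≤ A) (hB : 0 ≤ B) (hC : 0 ≤ C) (hW : 0 ≤ W)
    (hpp : 0 ≤ K p p) (hsymm : ∀ i, K i p = K p i) (hz : ∀ i, i ≠ p → ‖z i‖ ≤ ε * A)
    (hzp : ‖z p‖ ≤ W) (hKp : ∀ i, |K p i| ≤ ε * B) (hK : ∀ i l, |K i l| ≤ C) :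
    -((n * n : ℝ) * (W * A * B + A ^ 2 * C)) * ε ^ 2 ≤
      (∑ i, ∑ l, star (z i) * z l * (K i l : ℂ)).re := by
  have hterm : ∀ i l, -(W * A * B + A ^ 2 * C) * ε ^ 2 ≤ (star (z i) * z l * (K i l : ℂ)).re := by
    intro i l
    have hnn1 : 0 ≤ W * A * B * ε ^ 2 := by positivity
    have hnn2 : 0 ≤ A ^ 2 * C * ε ^ 2 := by positivity
    have hbound : ∀ x, ‖star (z i) * z l * (K i l : ℂ)‖ ≤ x →
        -x ≤ (star (z i) * z l * (K i l : ℂ)).re := fun x hx =>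
      (abs_le.1 ((Complex.abs_re_le_norm _).trans hx)).1
    have hnorm : ‖star (z i) * z l * (K i l : ℂ)‖ = ‖z i‖ * ‖z l‖ * |K i l| := by
      rw [norm_mul, norm_mul, norm_star, Complex.norm_real, Real.norm_eq_abs]
    by_cases hi : i = p
    · subst hi
      by_cases hl : l = i
      · subst hl
        have e : star (z l) * z l * (K l l : ℂ) = ((Complex.normSq (z l) * K l l : ℝ) : ℂ) := by
          push_cast
          rw [Complex.normSq_eq_conj_mul_self]
          rfl
        rw [e, Complex.ofReal_re]
        have := mul_nonneg (Complex.normSq_nonneg (z l)) hpp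
        linarith
      · refine le_trans ?_ (hbound (W * (ε * A) * (ε * B)) ?_)
        · linarith
        · rw [hnorm]
          have := hz l hl
          have := hKp l
          gcongr
    · by_cases hl : l = p
      · subst hl
        refine le_trans ?_ (hbound ((ε * A) * W * (ε * B)) ?_)
        · linarith
        · rw [hnorm, hsymm]
          have := hz i hi
          have := hKp i
          gcongr
      · refine le_trans ?_ (hbound ((ε * A) * (ε * A) * C) ?_)
        · linarith
        · rw [hnorm]
          have := hz i hi
          have := hz l hl
          have := hK i l
          gcongr
  rw [Complex.re_sum]
  have h1 : ∑ _i : Fin n, ∑ _l : Fin n, -(W * A * B + A ^ 2 * C) * ε ^ 2 ≤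
      ∑ i, (∑ l, star (z i) * z l * (K i l : ℂ)).re := by
    refine Finset.sum_le_sum fun i _ => ?_
    rw [Complex.re_sum]
    exact Finset.sum_le_sum fun l _ => hterm i l
  refine le_trans (le_of_eq ?_) h1
  simp only [Finset.sum_const, Finset.card_univ, Fintype.card_fin, nsmul_eq_mul]
  ring

theorem ConvexOn.eventually_abs_sub_le {S : Set ℝ} {f : ℝ → ℝ} (hS : IsOpen S)
    (hf : ConvexOn ℝ S f) {x : ℝ} (hx : x ∈ S) :
    ∀ᶠ C : ℝ in atTop, ∀ᶠ y in 𝓝 x, |f y - f x| ≤ C * |y - x| := by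
  obtain ⟨K, t, ht, hK⟩ := hf.locallyLipschitzOn hS hx
  rw [hS.nhdsWithin_eq hx] at ht
  filter_upwards [eventually_ge_atTop (K : ℝ)] with C hC
  filter_upwards [ht] with y hy
  have := hK.dist_le_mul y hy x (mem_of_mem_nhds ht)
  rw [Real.dist_eq, Real.dist_eq] at this
  exact this.trans (mul_le_mul_of_nonneg_right hC (abs_nonneg _))

/-- Supplies the bounds for `re_sum_ge_of_concentrated`: row `p` of the gap matrix vanishes at `ν =
lam p` and grows at most linearly by local Lipschitz continuity, while its diagonal entry is
nonnegative because `m` is a subgradient. -/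
theorem ConvexOn.eventually_secantGap_bounds {S : Set ℝ} {f m : ℝ → ℝ} (hS : IsOpen S)
    (hf : ConvexOn ℝ S f) {lam : Fin n → ℝ} (hinj : Function.Injective lam)
    (hlam : ∀ i, lam i ∈ S)
    (hm : ∀ i, ∀ x ∈ S, f (lam i) + m (lam i) * (x - lam i) ≤ f x) :
    ∀ᶠ C : ℝ in atTop, ∀ p, ∀ᶠ ν in 𝓝 (lam p), 0 ≤ secantGap f m ν (lam p) (lam p) ∧
      (∀ i, i ≠ p → 1 ≤ C * |ν - lam i|) ∧
      (∀ i, |secantGap f m ν (lam p) (lam i)| ≤ C * |ν - lam p|) ∧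
      ∀ i l, |secantGap f m ν (lam i) (lam l)| ≤ C := by
  rw [eventually_all]
  intro p
  have h1 : ∀ᶠ ν in 𝓝 (lam p), 0 ≤ secantGap f m ν (lam p) (lam p) := by
    filter_upwards [hS.mem_nhds (hlam p)] with ν hν
    have := hm p ν hν
    simp only [secantGap, secantSlope, if_true]
    linarith
  have h2 : ∀ᶠ C : ℝ in atTop, ∀ i, ∀ᶠ ν in 𝓝 (lam p), i ≠ p → 1 ≤ C * |ν - lam i| := by
    rw [eventually_all]
    intro i
    by_cases hi : i = p
    · simp [hi]
    have hpos : 0 < |lam p - lam i| := abs_pos.2 (sub_ne_zero.2 fun e => hi (hinj e).symm)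
    filter_upwards [eventually_ge_atTop (2 / |lam p - lam i|)] with C hC
    have ht : Tendsto (fun ν => |ν - lam i|) (𝓝 (lam p)) (𝓝 |lam p - lam i|) :=
      (continuous_abs.comp (continuous_id.sub continuous_const)).tendsto _
    filter_upwards [ht.eventually_const_lt (half_lt_self hpos)] with ν hν _
    have h3 : 2 / |lam p - lam i| * (|lam p - lam i| / 2) = 1 := by field_simp
    rw [← h3]
    have : 0 ≤ 2 / |lam p - lam i| := by positivity
    exact mul_le_mul hC hν.le (by positivity) (this.trans hC)
  have h3 : ∀ᶠ C : ℝ in atTop, ∀ i, ∀ᶠ ν in 𝓝 (lam p),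
      |secantGap f m ν (lam p) (lam i)| ≤ C * |ν - lam p| := by
    rw [eventually_all]
    intro i
    obtain ⟨C₀, hC₀⟩ := (hf.eventually_abs_sub_le hS (hlam p)).exists
    filter_upwards [eventually_ge_atTop (C₀ + |secantSlope f m (lam p) (lam i)|)] with C hC
    filter_upwards [hC₀] with ν hν
    rw [secantGap]
    calc |f ν - f (lam p) - (ν - lam p) * secantSlope f m (lam p) (lam i)|
        ≤ |f ν - f (lam p)| + |(ν - lam p) * secantSlope f m (lam p) (lam i)| := abs_sub _ _
      _ ≤ C₀ * |ν - lam p| + |ν - lam p| * |secantSlope f m (lam p) (lam i)| := by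
        rw [abs_mul]; gcongr
      _ = (C₀ + |secantSlope f m (lam p) (lam i)|) * |ν - lam p| := by ring
      _ ≤ C * |ν - lam p| := by gcongr
  have h4 : ∀ᶠ C : ℝ in atTop, ∀ i l, ∀ᶠ ν in 𝓝 (lam p),
      |secantGap f m ν (lam i) (lam l)| ≤ C := by
    rw [eventually_all]
    intro i
    rw [eventually_all]
    intro l
    have hfc : ContinuousAt f (lam p) :=
      (hf.locallyLipschitzOn hS).continuousOn.continuousAt (hS.mem_nhds (hlam p))
    have hc : ContinuousAt (fun ν => |secantGap f m ν (lam i) (lam l)|) (lam p) := by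
      unfold secantGap
      fun_prop
    filter_upwards [eventually_gt_atTop |secantGap f m (lam p) (lam i) (lam l)|] with C hC
    filter_upwards [hc.tendsto.eventually_lt_const hC] with ν hν using hν.le
  filter_upwards [h2, h3, h4] with C h2 h3 h4
  filter_upwards [h1, eventually_all.2 h2, eventually_all.2 h3,
    eventually_all.2 fun i => eventually_all.2 (h4 i)] with ν g1 g2 g3 g4
  exact ⟨g1, g2, g3, g4⟩

end Direct

section Direct

open Matrix

variable {n : ℕ}

/-- Eigenvectors of a perturbation of a diagonal matrix, in the basis of the unperturbed one. -/
theorem norm_sub_mul_le_of_perturbation {W H : Matrix (Fin n) (Fin n) ℂ} {lam ν : Fin n → ℝ} {s : ℝ}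
    (hs : 0 ≤ s) (hW : Wᴴ * W = 1)
    (h : diagonal (fun i => (lam i : ℂ)) + s • H = spectralMatrix W ν) (j i : Fin n) :
    |ν j - lam i| * ‖Wᴴ j i‖ ≤ s * ∑ k, ∑ l, ‖H k l‖ := by
  have hP : Wᴴ * Wᴴᴴ = 1 := by rwa [conjTranspose_conjTranspose]
  have e : Wᴴ * (diagonal (fun i => (lam i : ℂ)) + s • H) =
      diagonal (fun i => (ν i : ℂ)) * Wᴴ := by
    rw [h, spectralMatrix, ← mul_assoc, ← mul_assoc, hW, one_mul]
  have e' := congrFun (congrFun e j) i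
  rw [mul_add, Matrix.add_apply, mul_diagonal, diagonal_mul, mul_smul_comm, Matrix.smul_apply,
    Complex.real_smul] at e'
  have e'' : ((ν j - lam i : ℝ) : ℂ) * Wᴴ j i = (s : ℂ) * (Wᴴ * H) j i := by
    push_cast
    linear_combination -e'
  have hn := congrArg norm e''
  rw [norm_mul, norm_mul, Complex.norm_real, Complex.norm_real, Real.norm_eq_abs, Real.norm_eq_abs,
    abs_of_nonneg hs] at hn
  rw [hn]
  refine mul_le_mul_of_nonneg_left ?_ hs
  rw [mul_apply]
  refine (norm_sum_le _ _).trans (Finset.sum_le_sum fun k _ => ?_)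
  rw [norm_mul]
  have h1 := (norm_le_one_of_mul_conjTranspose hP j).1 k
  have h2 : ‖H k i‖ ≤ ∑ l, ‖H k l‖ :=
    Finset.single_le_sum (f := fun l => ‖H k l‖) (fun l _ => norm_nonneg _) (Finset.mem_univ i)
  exact (mul_le_of_le_one_left (norm_nonneg _) h1).trans h2

/-- For small perturbations of a diagonal matrix the remainder is bounded below to second order. -/
theorem ConvexOn.exists_gapForm_ge {S : Set ℝ} {f m : ℝ → ℝ} (hS : IsOpen S)
    (hf : ConvexOn ℝ S f) {lam : Fin n → ℝ} (hinj : Function.Injective lam)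
    (hlam : ∀ i, lam i ∈ S)
    (hm : ∀ i, ∀ x ∈ S, f (lam i) + m (lam i) * (x - lam i) ≤ f x)
    (H : Matrix (Fin n) (Fin n) ℂ) (w : Fin n → ℂ) :
    ∃ K : ℝ, ∀ᶠ s in 𝓝[>] (0 : ℝ), ∀ (W : Matrix (Fin n) (Fin n) ℂ) (ν : Fin n → ℝ),
      Wᴴ * W = 1 → diagonal (fun i => (lam i : ℂ)) + s • H = spectralMatrix W ν →
        -K * s ^ 2 ≤ (gapForm f m lam ν Wᴴ w).re := by
  obtain ⟨C, hC, hC0⟩ := ((hf.eventually_secantGap_bounds hS hinj hlam hm).and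
    (eventually_ge_atTop (0 : ℝ))).exists
  set K₀ : ℝ := ∑ k, ∑ l, ‖H k l‖ with hK₀
  have hK₀' : 0 ≤ K₀ := Finset.sum_nonneg fun k _ => Finset.sum_nonneg fun l _ => norm_nonneg _
  set R : ℝ := ∑ i, ‖w i‖ with hR
  have hR' : 0 ≤ R := Finset.sum_nonneg fun i _ => norm_nonneg _
  have hwR : ∀ i, ‖w i‖ ≤ R := fun i =>
    Finset.single_le_sum (f := fun i => ‖w i‖) (fun l _ => norm_nonneg _) (Finset.mem_univ i)
  refine ⟨n * ((n * n : ℝ) * (R * (C * K₀ * R) * (C * (n * K₀)) + (C * K₀ * R) ^ 2 * C)), ?_⟩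
  have hnear : ∀ᶠ s in 𝓝[>] (0 : ℝ), ∀ p ν, |ν - lam p| ≤ s * (n * K₀) →
      0 ≤ secantGap f m ν (lam p) (lam p) ∧ (∀ i, i ≠ p → 1 ≤ C * |ν - lam i|) ∧
      (∀ i, |secantGap f m ν (lam p) (lam i)| ≤ C * |ν - lam p|) ∧
      ∀ i l, |secantGap f m ν (lam i) (lam l)| ≤ C := by
    rw [eventually_all]
    intro p
    obtain ⟨ρ, hρ, hball⟩ := Metric.eventually_nhds_iff.1 (hC p)
    have ht : Tendsto (fun s : ℝ => s * (n * K₀)) (𝓝[>] 0) (𝓝 (0 * (n * K₀))) :=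
      (tendsto_id.mono_left nhdsWithin_le_nhds).mul_const _
    rw [zero_mul] at ht
    filter_upwards [ht.eventually_lt_const hρ] with s hs ν hν
    exact hball (by rw [Real.dist_eq]; exact hν.trans_lt hs)
  filter_upwards [hnear, self_mem_nhdsWithin] with s hs hspos W ν hW hWν
  have hs0 : (0 : ℝ) ≤ s := le_of_lt hspos
  have hP : Wᴴ * Wᴴᴴ = 1 := by rwa [conjTranspose_conjTranspose]
  have hrow : ∀ j, -((n * n : ℝ) * (R * (C * K₀ * R) * (C * (n * K₀)) + (C * K₀ * R) ^ 2 * C)) *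
      s ^ 2 ≤ (∑ i, ∑ l, star (Wᴴ j i * w i) * (Wᴴ j l * w l) *
        (secantGap f m (ν j) (lam i) (lam l) : ℂ)).re := by
    intro j
    -- A component of size at least `1 / n` turns the perturbation estimate into `|ν j - lam p| ≤ s
    -- n K₀`; the other eigenvalues are then far from `ν j`, which makes the other components of
    -- order `s`.
    obtain ⟨hle, p, hp⟩ := norm_le_one_of_mul_conjTranspose hP j
    have hpert := norm_sub_mul_le_of_perturbation hs0 hW hWν j
    have hνp : |ν j - lam p| ≤ s * (n * K₀) := by
      calc |ν j - lam p| ≤ |ν j - lam p| * (n * ‖Wᴴ j p‖) :=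
            le_mul_of_one_le_right (abs_nonneg _) hp
        _ = n * (|ν j - lam p| * ‖Wᴴ j p‖) := by ring
        _ ≤ n * (s * K₀) := mul_le_mul_of_nonneg_left (hpert p) (Nat.cast_nonneg n)
        _ = s * (n * K₀) := by ring
    obtain ⟨g1, g2, g3, g4⟩ := hs p (ν j) hνp
    refine re_sum_ge_of_concentrated (z := fun i => Wᴴ j i * w i)
      (K := fun i l => secantGap f m (ν j) (lam i) (lam l)) (p := p) hs0 (by positivity)
      (by positivity) hC0 hR' g1 (fun i => secantGap_comm _ _ _ _ _) (fun i hi => ?_) ?_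
      (fun i => ?_) g4
    · rw [norm_mul]
      have : ‖Wᴴ j i‖ ≤ s * (C * K₀) := by
        calc ‖Wᴴ j i‖ ≤ (C * |ν j - lam i|) * ‖Wᴴ j i‖ :=
              le_mul_of_one_le_left (norm_nonneg _) (g2 i hi)
          _ = C * (|ν j - lam i| * ‖Wᴴ j i‖) := by ring
          _ ≤ C * (s * K₀) := mul_le_mul_of_nonneg_left (hpert i) hC0
          _ = s * (C * K₀) := by ring
      calc ‖Wᴴ j i‖ * ‖w i‖ ≤ s * (C * K₀) * R := by
            have := hwR i
            gcongr
        _ = s * (C * K₀ * R) := by ring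
    · rw [norm_mul]
      exact (mul_le_of_le_one_left (norm_nonneg _) (hle p)).trans (hwR p)
    · calc |secantGap f m (ν j) (lam p) (lam i)| ≤ C * |ν j - lam p| := g3 i
        _ ≤ C * (s * (n * K₀)) := mul_le_mul_of_nonneg_left hνp hC0
        _ = s * (C * (n * K₀)) := by ring
  rw [gapForm, Complex.re_sum]
  refine le_trans (le_of_eq ?_) (Finset.sum_le_sum fun j _ => hrow j)
  rw [Finset.sum_const, Finset.card_univ, Fintype.card_fin, nsmul_eq_mul]
  ring

/-- In the convexity inequality at `C + s (M - C)` the linear terms cancel, so the remainder there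
is at most `s` times the remainder at `M`. It is also at least `-K s²`; divide by `s` and let `s →
0`. -/
theorem MatrixConvexOfOrder.gapForm_nonneg (hn : 1 ≤ n) {a b : EReal} {f m : ℝ → ℝ}
    (h : MatrixConvexOfOrder n a b f) {lam : Fin n → ℝ} (hinj : Function.Injective lam)
    (hlam : ∀ i, lam i ∈ openInterval a b)
    (hm : ∀ i, ∀ x ∈ openInterval a b, f (lam i) + m (lam i) * (x - lam i) ≤ f x)
    {U : Matrix (Fin n) (Fin n) ℂ} (hU : Uᴴ * U = 1) (hU' : U * Uᴴ = 1) {μ : Fin n → ℝ}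
    (hμ : ∀ i, μ i ∈ openInterval a b) (w : Fin n → ℂ) :
    0 ≤ (gapForm f m lam μ Uᴴ w).re := by
  have hone : (1 : Matrix (Fin n) (Fin n) ℂ)ᴴ * 1 = 1 := by simp
  have hone' : (1 : Matrix (Fin n) (Fin n) ℂ) * 1ᴴ = 1 := by simp
  set M := spectralMatrix U μ with hM
  set C := spectralMatrix (1 : Matrix (Fin n) (Fin n) ℂ) lam with hC
  obtain ⟨K, hK⟩ := (h.convexOn hn).exists_gapForm_ge (isOpen_openInterval a b) hinj hlam hm
    (M - C) w
  have hspecM : spectrum ℝ M ⊆ openInterval a b := fun x hx => by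
    obtain ⟨i, rfl⟩ := spectrum_spectralMatrix_subset hU hU' hx
    exact hμ i
  have hspecC : spectrum ℝ C ⊆ openInterval a b := fun x hx => by
    obtain ⟨i, rfl⟩ := spectrum_spectralMatrix_subset hone hone' hx
    exact hlam i
  have hlow : ∀ᶠ s in 𝓝[>] (0 : ℝ), -K * s ≤ (gapForm f m lam μ Uᴴ w).re := by
    have h1 : ∀ᶠ s in 𝓝[>] (0 : ℝ), s ≤ 1 :=
      (eventually_le_nhds (zero_lt_one (α := ℝ))).filter_mono nhdsWithin_le_nhds
    filter_upwards [hK, h1, self_mem_nhdsWithin] with s hs hs1 hspos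
    have hspos' : (0 : ℝ) < s := hspos
    have hMh : M.IsHermitian := isHermitian_spectralMatrix _ _
    have hCh : C.IsHermitian := isHermitian_spectralMatrix _ _
    obtain ⟨W, ν, hW, hW', -, -, hN, hfN⟩ :=
      exists_eq_spectralMatrix (isHermitian_real_combination hMh hCh s (1 - s))
    have hconv := h M C hMh hCh hspecM hspecC s hspos'.le hs1
    rw [hfN, hM, hC, cfc_spectralMatrix hU hU', cfc_spectralMatrix hone hone', Matrix.le_iff]
      at hconv
    have hq := hconv.re_dotProduct_nonneg w
    rw [sub_mulVec, dotProduct_sub, re_dotProduct_combination] at hq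
    have hN' : diagonal (fun i => (lam i : ℂ)) + s • (M - C) = spectralMatrix W ν := by
      rw [← hN, ← spectralMatrix_one, ← hC]
      module
    have hg := hs W ν hW hN'
    have eM := dotProduct_spectralMatrix_eq f m (lam := lam) (μ := μ) hU' hone hone' w
    have eN := dotProduct_spectralMatrix_eq f m (lam := lam) (μ := ν) hW' hone hone' w
    simp only [conjTranspose_one, one_mul, mul_one, one_mulVec] at eM eN
    rw [← hN, ← hC, slopeForm_add, slopeForm_smul, slopeForm_smul] at eN
    rw [← hM, ← hC] at eM
    rw [eN, eM] at hq
    simp only [RCLike.re_to_complex, Complex.add_re, Complex.sub_re, Complex.re_ofReal_mul] at hq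
    have h2 : (gapForm f m lam ν Wᴴ w).re ≤ s * (gapForm f m lam μ Uᴴ w).re := by
      linear_combination hq
    have h3 : s * (-K * s) ≤ s * (gapForm f m lam μ Uᴴ w).re := by
      refine le_trans (le_of_eq ?_) (hg.trans h2)
      ring
    exact le_of_mul_le_mul_left h3 hspos'
  have ht : Tendsto (fun s : ℝ => -K * s) (𝓝[>] 0) (𝓝 (-K * 0)) :=
    (tendsto_id.mono_left nhdsWithin_le_nhds).const_mul _
  rw [mul_zero] at ht
  exact le_of_tendsto ht hlow

end Direct

/-! ### Isolating the gap form of a single eigenvalue. -/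

section Householder

open Matrix

variable {n : ℕ}

/-- The reflection in the hyperplane orthogonal to `u`. -/
noncomputable def householder (u : Fin n → ℝ) : Matrix (Fin n) (Fin n) ℝ :=
  fun i j => (if i = j then 1 else 0) - 2 / (∑ k, u k ^ 2) * (u i * u j)

theorem householder_transpose (u : Fin n → ℝ) : (householder u)ᵀ = householder u := by
  ext i j
  simp only [transpose_apply, householder, eq_comm (a := j), mul_comm (u j)]

theorem householder_mul_self {u : Fin n → ℝ} (hu : ∑ k, u k ^ 2 ≠ 0) :
    householder u * householder u = 1 := by
  set N := ∑ k, u k ^ 2 with hN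
  have e : householder u = 1 - (2 / N) • vecMulVec u u := by
    ext i j
    simp [householder, one_apply, vecMulVec_apply, hN]
  have hdot : u ⬝ᵥ u = N := by
    rw [hN, dotProduct]
    exact Finset.sum_congr rfl fun k _ => (pow_two _).symm
  have e2 : vecMulVec u u * vecMulVec u u = N • vecMulVec u u := by
    rw [vecMulVec_mul_vecMulVec, hdot, vecMulVec_smul]
  rw [e, sub_mul, mul_sub, mul_sub, one_mul, mul_one, one_mul, smul_mul_smul_comm, e2, smul_smul]
  have : 2 / N * (2 / N) * N = 2 / N + 2 / N := by field_simp; ring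
  rw [this]
  module

theorem gapForm_ofReal (f m : ℝ → ℝ) (lam μ : Fin n → ℝ) (P : Matrix (Fin n) (Fin n) ℝ)
    (w : Fin n → ℝ) :
    (gapForm f m lam μ (P.map ((↑) : ℝ → ℂ)) fun i => (w i : ℂ)).re =
      ∑ k, ∑ i, ∑ l, P k i * w i * (P k l * w l) * secantGap f m (μ k) (lam i) (lam l) := by
  have : gapForm f m lam μ (P.map ((↑) : ℝ → ℂ)) (fun i => (w i : ℂ)) =
      ((∑ k, ∑ i, ∑ l, P k i * w i * (P k l * w l) *
        secantGap f m (μ k) (lam i) (lam l) : ℝ) : ℂ) := by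
    simp [gapForm]
  rw [this, Complex.ofReal_re]

/-- The gap form is a sum over the eigenvalues of `M`. Give `M` the eigenvalue `κ` at one index `o`
and `lam k` elsewhere, with eigenvectors close to the standard basis, and choose the vector so that
row `o` contributes exactly the wanted form while the other rows fade out. -/
theorem MatrixConvexOfOrder.sum_secantGap_nonneg (hn : 1 ≤ n) {a b : EReal} {f m : ℝ → ℝ}
    (h : MatrixConvexOfOrder n a b f) {lam : Fin n → ℝ} (hinj : Function.Injective lam)
    (hlam : ∀ i, lam i ∈ openInterval a b)
    (hm : ∀ i, ∀ x ∈ openInterval a b, f (lam i) + m (lam i) * (x - lam i) ≤ f x)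
    {κ : ℝ} (hκ : κ ∈ openInterval a b) (d : Fin n → ℝ) :
    0 ≤ ∑ i, ∑ l, d i * d l * secantGap f m κ (lam i) (lam l) := by
  set o : Fin n := ⟨0, hn⟩
  -- In row `o` of the reflection the off-diagonal entries are of order `η` and nonzero;
  -- off-diagonal entries outside row and column `o` are of order `η²`. So dividing by row `o` still
  -- leaves quantities that tend to 0.
  set u : ℝ → Fin n → ℝ := fun η i => if i = o then 1 else η with hu
  set N : ℝ → ℝ := fun η => ∑ k, u η k ^ 2 with hN
  set P : ℝ → Matrix (Fin n) (Fin n) ℝ := fun η => householder (u η) with hP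
  set μ : Fin n → ℝ := Function.update lam o κ with hμ
  have hμI : ∀ i, μ i ∈ openInterval a b := fun i => by
    by_cases hi : i = o
    · rw [hμ, hi, Function.update_self]; exact hκ
    · rw [hμ, Function.update_of_ne hi]; exact hlam i
  have hNpos : ∀ η, 0 < N η := fun η => by
    refine Finset.sum_pos' (fun k _ => sq_nonneg _) ⟨o, Finset.mem_univ o, ?_⟩
    simp [hu]
  have hNlim : Tendsto N (𝓝[>] 0) (𝓝 1) := by
    have hc : Continuous N := by
      refine continuous_finsetSum _ fun k _ => ?_
      by_cases hk : k = o
      · simp only [hu, hk, if_true]; fun_prop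
      · simp only [hu, hk, if_false]; fun_prop
    have h0 : N 0 = 1 := by
      simp [hN, hu]
    rw [← h0]
    exact (hc.tendsto 0).mono_left nhdsWithin_le_nhds
  have hη : Tendsto (fun η : ℝ => η) (𝓝[>] 0) (𝓝 0) := tendsto_id.mono_left nhdsWithin_le_nhds
  have hdiag : Tendsto (fun η => P η o o) (𝓝[>] 0) (𝓝 (-1)) := by
    have : Tendsto (fun η => 1 - 2 / N η) (𝓝[>] 0) (𝓝 (1 - 2 / 1)) :=
      tendsto_const_nhds.sub (tendsto_const_nhds.div hNlim one_ne_zero)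
    refine (this.congr fun η => ?_).trans (by norm_num)
    simp [hP, householder, hu, hN]
  have hrow : ∀ η i, i ≠ o → P η o i = -(2 / N η * η) := fun η i hi => by
    simp [hP, householder, hu, hN, hi, Ne.symm hi]
  have hcol : ∀ η k, k ≠ o → P η k o = -(2 / N η * η) := fun η k hk => by
    simp [hP, householder, hu, hN, hk]
  have hoff : ∀ η k i, k ≠ o → i ≠ o → i ≠ k → P η k i = -(2 / N η * (η * η)) :=
    fun η k i hk hi hki => by
      simp [hP, householder, hu, hN, hk, hi, Ne.symm hki]
  have hne : ∀ᶠ η in 𝓝[>] (0 : ℝ), ∀ i, P η o i ≠ 0 := by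
    rw [eventually_all]
    intro i
    by_cases hi : i = o
    · rw [hi]
      exact hdiag.eventually_ne (by norm_num)
    · filter_upwards [self_mem_nhdsWithin] with η hηpos
      rw [hrow η i hi]
      have : (0 : ℝ) < η := hηpos
      have := hNpos η
      exact neg_ne_zero.2 (by positivity)
  have hratio : ∀ k i, k ≠ o → i ≠ k →
      Tendsto (fun η => P η k i * (d i / P η o i)) (𝓝[>] 0) (𝓝 0) := by
    intro k i hk hik
    by_cases hi : i = o
    · subst hi
      have h1 : Tendsto (fun η => -(2 / N η * η)) (𝓝[>] 0) (𝓝 (-(2 / 1 * 0))) :=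
        ((tendsto_const_nhds.div hNlim one_ne_zero).mul hη).neg
      have h2 := h1.mul ((tendsto_const_nhds (x := d o)).div hdiag (by norm_num))
      simp only [mul_zero, neg_zero, zero_mul] at h2
      refine h2.congr fun η => ?_
      rw [hcol η k hk]
      rfl
    · have h1 : Tendsto (fun η : ℝ => η * d i) (𝓝[>] 0) (𝓝 (0 * d i)) := hη.mul_const _
      rw [zero_mul] at h1
      refine h1.congr' ?_
      filter_upwards [self_mem_nhdsWithin] with η hηpos
      rw [hoff η k i hk hi hik, hrow η i hi]
      have h2 : η ≠ 0 := ne_of_gt hηpos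
      have h3 := (hNpos η).ne'
      field_simp
  have hlim : Tendsto (fun η => ∑ k, ∑ i, ∑ l, P η k i * (d i / P η o i) *
      (P η k l * (d l / P η o l)) * secantGap f m (μ k) (lam i) (lam l)) (𝓝[>] 0)
      (𝓝 (∑ k, if k = o then ∑ i, ∑ l, d i * d l * secantGap f m κ (lam i) (lam l) else 0)) := by
    refine tendsto_finsetSum _ fun k _ => ?_
    by_cases hk : k = o
    · rw [if_pos hk, hk]
      refine tendsto_const_nhds.congr' ?_
      filter_upwards [hne] with η hη0
      refine Finset.sum_congr rfl fun i _ => Finset.sum_congr rfl fun l _ => ?_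
      rw [mul_div_cancel₀ _ (hη0 i), mul_div_cancel₀ _ (hη0 l), hμ, Function.update_self]
    · rw [if_neg hk]
      have hμk : μ k = lam k := by rw [hμ, Function.update_of_ne hk]
      have : (0 : ℝ) = ∑ _i : Fin n, ∑ _l : Fin n, 0 := by simp
      rw [this]
      refine tendsto_finsetSum _ fun i _ => tendsto_finsetSum _ fun l _ => ?_
      -- The diagonal entry `P η k k` divided by `P η o k` is unbounded when `d k ≠ 0`, but it only
      -- meets gaps that vanish because `μ k = lam k`.
      by_cases hik : i = k
      · simp only [hμk, hik, secantGap_self_left, mul_zero]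
        exact tendsto_const_nhds
      by_cases hlk : l = k
      · simp only [hμk, hlk, secantGap_self_right, mul_zero]
        exact tendsto_const_nhds
      have := ((hratio k i hk hik).mul (hratio k l hk hlk)).mul_const
        (secantGap f m (μ k) (lam i) (lam l))
      simpa using this
  rw [Finset.sum_ite_eq' Finset.univ o, if_pos (Finset.mem_univ o)] at hlim
  -- Nonnegativity holds for every vector, hence also where some `P η o i` is zero and the quotient
  -- takes its default value.
  refine ge_of_tendsto hlim (Eventually.of_forall fun η => ?_)
  set U : Matrix (Fin n) (Fin n) ℂ := (P η).map ((↑) : ℝ → ℂ) with hU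
  have hUh : Uᴴ = U := by
    ext i j
    have := congrFun (congrFun (householder_transpose (u η)) i) j
    rw [transpose_apply] at this
    simp [hU, hP, conjTranspose_apply, this]
  have hUU : U * U = 1 := by
    have h1 := householder_mul_self (u := u η) (hNpos η).ne'
    have h2 := congrArg (fun M : Matrix (Fin n) (Fin n) ℝ => M.map (algebraMap ℝ ℂ)) h1
    simp only [Matrix.map_mul] at h2
    rw [Matrix.map_one _ (map_zero _) (map_one _)] at h2
    exact h2
  have hpos := h.gapForm_nonneg hn hinj hlam hm (U := U) (by rw [hUh, hUU]) (by rw [hUh, hUU])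
    hμI fun i => ((d i / P η o i : ℝ) : ℂ)
  rw [hUh, hU, gapForm_ofReal] at hpos
  exact hpos

end Householder

/-! ### From double nodes back to distinct nodes. -/

section Bisection

variable {n : ℕ}

/-- The slope over an interval is the mean of the slopes over its halves, so one half has slope at
most `c`. No regularity of `h` is needed. -/
theorem exists_short_interval_slope_le (h : ℝ → ℝ) {y y' c δ : ℝ} (hy : y < y') (hδ : 0 < δ)
    (hc : (h y' - h y) / (y' - y) ≤ c) :
    ∃ z z', y ≤ z ∧ z < z' ∧ z' ≤ y' ∧ z' - z < δ ∧ (h z' - h z) / (z' - z) ≤ c := by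
  have hk : ∀ k : ℕ, ∃ z z', y ≤ z ∧ z < z' ∧ z' ≤ y' ∧ z' - z = (y' - y) / 2 ^ k ∧
      (h z' - h z) / (z' - z) ≤ c := by
    intro k
    induction k with
    | zero => exact ⟨y, y', le_rfl, hy, le_rfl, by simp, hc⟩
    | succ k ih =>
      obtain ⟨z, z', h1, h2, h3, h4, h5⟩ := ih
      set w := (z + z') / 2 with hw
      have hzw : z < w := by rw [hw]; linarith
      have hwz : w < z' := by rw [hw]; linarith
      have hlen : z' - w = (y' - y) / 2 ^ (k + 1) := by
        rw [pow_succ, ← div_div, ← h4, hw]; ring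
      have hlen' : w - z = (y' - y) / 2 ^ (k + 1) := by
        rw [pow_succ, ← div_div, ← h4, hw]; ring
      by_cases hcase : (h w - h z) / (w - z) ≤ c
      · exact ⟨z, w, h1, hzw, hwz.le.trans h3, hlen', hcase⟩
      · refine ⟨w, z', h1.trans hzw.le, hwz, h3, hlen, ?_⟩
        rw [div_le_iff₀ (by linarith)] at h5 hcase ⊢
        have : (z' - z) = (z' - w) + (w - z) := by ring
        rw [this] at h5
        linarith
  obtain ⟨k, hk'⟩ := exists_pow_lt_of_lt_one (div_pos hδ (sub_pos.2 hy))
    (by norm_num : (1 / 2 : ℝ) < 1)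
  obtain ⟨z, z', h1, h2, h3, h4, h5⟩ := hk k
  refine ⟨z, z', h1, h2, h3, ?_, h5⟩
  rw [h4]
  rw [lt_div_iff₀ (sub_pos.2 hy)] at hk'
  rw [one_div, inv_pow] at hk'
  rw [div_eq_inv_mul]
  exact hk'

theorem image_update_eq (y : Fin n → ℝ) (i : Fin n) (z : ℝ) :
    Finset.univ.image (Function.update y i z) = insert z ((Finset.univ.erase i).image y) := by
  rw [← Finset.insert_erase (Finset.mem_univ i), Finset.image_insert, Function.update_self,
    Finset.erase_insert (Finset.notMem_erase i _)]
  congr 1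
  exact Finset.image_congr fun j hj => Function.update_of_ne (Finset.ne_of_mem_erase hj) _ _

theorem pairNodes_update (y y' : Fin n → ℝ) (μ : ℝ) (i : Fin n) (z z' : ℝ) :
    pairNodes (Function.update y i z) (Function.update y' i z') μ =
      insert z' (insert z (insert μ
        ((Finset.univ.erase i).image y ∪ (Finset.univ.erase i).image y'))) := by
  rw [pairNodes, image_update_eq, image_update_eq]
  ext w
  simp only [Finset.mem_insert, Finset.mem_union]
  tauto

/-- If a divided difference with nodes in pairs is at most `c`, then so is one with narrow pairs,
nested in the original ones. -/
theorem exists_narrow_pairs (g : ℝ → ℝ) {α β : Fin n → ℝ} {μ c δ : ℝ} (hδ : 0 < δ)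
    (hαβ : ∀ i, α i < β i)
    (hsep : ∀ i j, i ≠ j → Disjoint (Set.Icc (α i) (β i)) (Set.Icc (α j) (β j)))
    (hμ : ∀ i, μ ∉ Set.Icc (α i) (β i))
    (hc : finsetDividedDifference g (pairNodes α β μ) ≤ c) (S : Finset (Fin n)) :
    ∃ y y' : Fin n → ℝ, (∀ i, α i ≤ y i ∧ y i < y' i ∧ y' i ≤ β i) ∧
      (∀ i ∈ S, y' i - y i < δ) ∧ finsetDividedDifference g (pairNodes y y' μ) ≤ c := by
  induction S using Finset.induction_on with
  | empty => exact ⟨α, β, fun i => ⟨le_rfl, hαβ i, le_rfl⟩, by simp, hc⟩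
  | insert i S hi ih =>
    obtain ⟨y, y', hy, hS, hle⟩ := ih
    set T : Finset ℝ :=
      insert μ ((Finset.univ.erase i).image y ∪ (Finset.univ.erase i).image y') with hT
    have hnot : ∀ x ∈ Set.Icc (α i) (β i), x ∉ T := by
      intro x hx hxT
      simp only [hT, Finset.mem_insert, Finset.mem_union, Finset.mem_image, Finset.mem_erase,
        Finset.mem_univ, and_true] at hxT
      rcases hxT with rfl | ⟨j, hj, rfl⟩ | ⟨j, hj, rfl⟩
      · exact hμ i hx
      · exact Set.disjoint_left.1 (hsep i j (Ne.symm hj)) hx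
          ⟨(hy j).1, (hy j).2.1.le.trans (hy j).2.2⟩
      · exact Set.disjoint_left.1 (hsep i j (Ne.symm hj)) hx
          ⟨(hy j).1.trans (hy j).2.1.le, (hy j).2.2⟩
    -- With the other nodes fixed, the divided difference is the slope between `z` and `z'` of a
    -- function of one node, so bisection applies to one pair at a time.
    have hdd : ∀ z z', α i ≤ z → z < z' → z' ≤ β i →
        finsetDividedDifference g
          (pairNodes (Function.update y i z) (Function.update y' i z') μ) =
        (finsetDividedDifference g (insert z' T) - finsetDividedDifference g (insert z T)) /
          (z' - z) := by
      intro z z' h1 h2 h3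
      rw [pairNodes_update]
      exact finsetDividedDifference_insert_insert g (hnot z' ⟨h1.trans h2.le, h3⟩)
        (hnot z ⟨h1, h2.le.trans h3⟩) h2.ne'
    have hle' := hdd (y i) (y' i) (hy i).1 (hy i).2.1 (hy i).2.2
    rw [Function.update_eq_self, Function.update_eq_self] at hle'
    rw [hle'] at hle
    obtain ⟨z, z', h1, h2, h3, h4, h5⟩ := exists_short_interval_slope_le
      (fun x => finsetDividedDifference g (insert x T)) (hy i).2.1 hδ hle
    refine ⟨Function.update y i z, Function.update y' i z', fun j => ?_, fun j hj => ?_, ?_⟩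
    · by_cases hj : j = i
      · subst hj
        simp only [Function.update_self]
        exact ⟨(hy j).1.trans h1, h2, h3.trans (hy j).2.2⟩
      · simp only [Function.update_of_ne hj]
        exact hy j
    · by_cases hji : j = i
      · subst hji
        simpa only [Function.update_self] using h4
      · simp only [Function.update_of_ne hji]
        exact hS j ((Finset.mem_insert.1 hj).resolve_left hji)
    · rw [hdd z z' ((hy i).1.trans h1) h2 (h3.trans (hy i).2.2)]
      exact h5

theorem exists_tendsto_of_mem_Icc {ι : Type*} (l : Ultrafilter ι) {u : ι → ℝ} {c d : ℝ}
    (h : ∀ᶠ k in (l : Filter ι), u k ∈ Set.Icc c d) :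
    ∃ x ∈ Set.Icc c d, Tendsto u l (𝓝 x) := by
  obtain ⟨x, hx, hle⟩ := isCompact_Icc.ultrafilter_le_nhds' (l.map u) h
  exact ⟨x, hx, hle⟩

/-- Limits of difference quotients of a convex function along an ultrafilter exist and are
subgradients. -/
theorem ConvexOn.exists_pairTendsto_subgradient {ι : Type*} (l : Ultrafilter ι) {S : Set ℝ}
    {f : ℝ → ℝ} (hS : IsOpen S) (hf : ConvexOn ℝ S f) {y y' : ι → ℝ} {x : ℝ} (hx : x ∈ S)
    (hlt : ∀ k, y k < y' k) (hy : Tendsto y l (𝓝 x)) (hy' : Tendsto y' l (𝓝 x)) :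
    ∃ m, PairTendsto (l : Filter ι) y y' (fun _ => f) (f x) m ∧
      ∀ z ∈ S, f x + m * (z - x) ≤ f z := by
  have hcont : ContinuousAt f x :=
    (hf.locallyLipschitzOn hS).continuousOn.continuousAt (hS.mem_nhds hx)
  have hyS := hy.eventually_mem (hS.mem_nhds hx)
  have hyS' := hy'.eventually_mem (hS.mem_nhds hx)
  obtain ⟨K, t, ht, hK⟩ := hf.locallyLipschitzOn hS hx
  rw [hS.nhdsWithin_eq hx] at ht
  have hbdd : ∀ᶠ k in (l : Filter ι), (f (y' k) - f (y k)) / (y' k - y k) ∈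
      Set.Icc (-(K : ℝ)) K := by
    filter_upwards [hy.eventually_mem ht, hy'.eventually_mem ht] with k h1 h2
    have := hK.dist_le_mul _ h2 _ h1
    rw [Real.dist_eq, Real.dist_eq] at this
    rw [Set.mem_Icc, ← abs_le, abs_div, div_le_iff₀ (abs_pos.2 (sub_ne_zero.2 (hlt k).ne'))]
    exact this
  obtain ⟨m, -, hm⟩ := exists_tendsto_of_mem_Icc l hbdd
  have hfy := hcont.tendsto.comp hy
  have hfy' := hcont.tendsto.comp hy'
  refine ⟨m, ⟨hfy, hfy', hm⟩, fun z hz => ?_⟩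
  rcases lt_trichotomy z x with hzx | rfl | hzx
  · have hlim1 : Tendsto (fun k => f (y k) - f z) l (𝓝 (f x - f z)) := hfy.sub_const _
    have hlim2 : Tendsto (fun k => (f (y' k) - f (y k)) / (y' k - y k) * (y k - z)) l
        (𝓝 (m * (x - z))) := hm.mul (hy.sub_const z)
    have := le_of_tendsto_of_tendsto hlim1 hlim2 (by
      filter_upwards [hy.eventually_const_lt hzx, hyS'] with k hk hkS
      have := hf.slope_mono_adjacent hz hkS hk (hlt k)
      rwa [div_le_iff₀ (sub_pos.2 hk)] at this)
    linarith
  · simp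
  · have hlim1 : Tendsto (fun k => f z - f (y' k)) l (𝓝 (f z - f x)) := hfy'.const_sub _
    have hlim2 : Tendsto (fun k => (f (y' k) - f (y k)) / (y' k - y k) * (z - y' k)) l
        (𝓝 (m * (z - x))) := hm.mul (hy'.const_sub z)
    have := le_of_tendsto_of_tendsto hlim2 hlim1 (by
      filter_upwards [hy'.eventually_lt_const hzx, hyS] with k hk hkS
      have := hf.slope_mono_adjacent hkS hz (hlt k) hk
      rwa [le_div_iff₀ (sub_pos.2 hk)] at this)
    linarith

/-- A divided difference with nodes in separated pairs is nonnegative for matrix convex `f`. -/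
theorem MatrixConvexOfOrder.finsetDividedDifference_pairNodes_nonneg (hn : 1 ≤ n) {a b : EReal}
    {f : ℝ → ℝ} (h : MatrixConvexOfOrder n a b f) {q : Polynomial ℝ} (hq : q.natDegree ≤ n - 1)
    {α β : Fin n → ℝ} {μ : ℝ} (hαβ : ∀ i, α i < β i)
    (hsep : ∀ i j, i ≠ j → Disjoint (Set.Icc (α i) (β i)) (Set.Icc (α j) (β j)))
    (hμ : ∀ i, μ ∉ Set.Icc (α i) (β i)) (hα : ∀ i, α i ∈ openInterval a b)
    (hβ : ∀ i, β i ∈ openInterval a b) (hμI : μ ∈ openInterval a b) :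
    0 ≤ finsetDividedDifference (fun y => f y * q.eval y ^ 2) (pairNodes α β μ) := by
  by_contra! hneg
  set g : ℝ → ℝ := fun y => f y * q.eval y ^ 2
  have hconv := h.convexOn hn
  choose y y' hy hwidth hle using fun k : ℕ => exists_narrow_pairs g
    (δ := 1 / ((k : ℝ) + 1)) (by positivity) hαβ hsep hμ le_rfl Finset.univ
  -- Along an ultrafilter all the bounded quantities, nodes and difference quotients alike, converge
  -- without extracting subsequences.
  set l : Ultrafilter ℕ := Filter.hyperfilter ℕ with hl
  have hex : ∀ i, ∃ x ∈ Set.Icc (α i) (β i), Tendsto (fun k => y k i) l (𝓝 x) := fun i =>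
    exists_tendsto_of_mem_Icc l (Eventually.of_forall fun k =>
      ⟨(hy k i).1, (hy k i).2.1.le.trans (hy k i).2.2⟩)
  choose s hs hys using hex
  have hlatTop : (l : Filter ℕ) ≤ atTop := by
    rw [hl, ← Nat.cofinite_eq_atTop]
    exact Filter.hyperfilter_le_cofinite
  have hys' : ∀ i, Tendsto (fun k => y' k i) l (𝓝 (s i)) := fun i => by
    have h0 : Tendsto (fun k => y' k i - y k i) l (𝓝 0) := by
      refine squeeze_zero (fun k => (sub_pos.2 (hy k i).2.1).le)
        (fun k => (hwidth k i (Finset.mem_univ i)).le) ?_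
      exact tendsto_one_div_add_atTop_nhds_zero_nat.mono_left hlatTop
    have := h0.add (hys i)
    simpa using this
  have hsI : ∀ i, s i ∈ openInterval a b := fun i =>
    (ordConnected_openInterval a b).out (hα i) (hβ i) (hs i)
  have hsinj : Function.Injective s := fun i j hij => by
    by_contra hne
    exact Set.disjoint_left.1 (hsep i j hne) (hs i) (hij ▸ hs j)
  have hsμ : ∀ i, s i ≠ μ := fun i e => hμ i (e ▸ hs i)
  choose M hM hsub using fun i => hconv.exists_pairTendsto_subgradient l
    (isOpen_openInterval a b) (hsI i) (fun k => (hy k i).2.1) (hys i) (hys' i)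
  -- Only the values of `m` at the `s i` matter; the value 0 elsewhere is arbitrary.
  set m : ℝ → ℝ := Function.extend s M 0
  have hm : ∀ i, m (s i) = M i := fun i => hsinj.extend_apply M 0 i
  have hmem : ∀ k i, y k i ∈ Set.Icc (α i) (β i) := fun k i =>
    ⟨(hy k i).1, (hy k i).2.1.le.trans (hy k i).2.2⟩
  have hmem' : ∀ k i, y' k i ∈ Set.Icc (α i) (β i) := fun k i =>
    ⟨(hy k i).1.trans (hy k i).2.1.le, (hy k i).2.2⟩
  have hdist : ∀ k, PairsDistinct (y k) (y' k) μ := fun k => by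
    refine ⟨fun i j hij => ?_, fun i j hij => ?_, fun i j hij => ?_,
      fun i e => hμ i (e ▸ hmem k i), fun i e => hμ i (e ▸ hmem' k i)⟩
    · by_contra hne
      exact Set.disjoint_left.1 (hsep i j hne) (hmem k i) (hij ▸ hmem k j)
    · by_contra hne
      exact Set.disjoint_left.1 (hsep i j hne) (hmem' k i) (hij ▸ hmem' k j)
    · by_cases hne : i = j
      · subst hne
        exact (hy k i).2.1.ne hij
      · exact Set.disjoint_left.1 (hsep i j hne) (hmem k i) (hij ▸ hmem' k j)
  have ht := tendsto_finsetDividedDifference_pairNodes (l := (l : Filter ℕ)) (m := m)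
    (degree_lt_of_natDegree_le_pred hn hq) hsinj hsμ (Eventually.of_forall hdist) hys hys'
    (fun i => by rw [hm]; exact hM i)
  have hpos := h.sum_secantGap_nonneg hn hsinj hsI (m := m) (fun i x hx => by
    rw [hm]; exact hsub i x hx) hμI fun i => lagrangeCoeff q s i / (μ - s i)
  have hlim := le_of_tendsto ht (Eventually.of_forall hle)
  exact absurd (hpos.trans hlim) (not_le.2 hneg)

/-- Sorting the nodes and pairing neighbours makes the intervals spanned by the pairs disjoint; the
largest node remains single. -/
theorem MatrixConvexOfOrder.dividedDifferenceCondition (hn : 1 ≤ n) {a b : EReal} {f : ℝ → ℝ}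
    (h : MatrixConvexOfOrder n a b f) : DividedDifferenceCondition n a b f := by
  intro q hq t ht htI
  set x := t.orderEmbOfFin ht with hx
  set α : Fin n → ℝ := fun i => x ⟨2 * i, by omega⟩ with hα
  set β : Fin n → ℝ := fun i => x ⟨2 * i + 1, by omega⟩ with hβ
  set μ : ℝ := x ⟨2 * n, by omega⟩ with hμ
  have hxt : ∀ i, x i ∈ t := fun i => t.orderEmbOfFin_mem ht i
  have hαβ : ∀ i, α i < β i := fun i => x.strictMono (Fin.mk_lt_mk.2 (by omega))
  have hβα : ∀ i j : Fin n, i < j → β i < α j := fun i j hij =>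
    x.strictMono (Fin.mk_lt_mk.2 (by have := Fin.lt_def.1 hij; omega))
  have hβμ : ∀ i, β i < μ := fun i => x.strictMono (Fin.mk_lt_mk.2 (by omega))
  have hsep : ∀ i j, i ≠ j → Disjoint (Set.Icc (α i) (β i)) (Set.Icc (α j) (β j)) := by
    intro i j hij
    refine Set.disjoint_left.2 fun z hz hz' => ?_
    rcases lt_or_gt_of_ne hij with hlt | hlt
    · exact absurd (hz'.1.trans hz.2) (not_le.2 (hβα i j hlt))
    · exact absurd (hz.1.trans hz'.2) (not_le.2 (hβα j i hlt))
  have hμn : ∀ i, μ ∉ Set.Icc (α i) (β i) := fun i hi => absurd hi.2 (not_le.2 (hβμ i))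
  have hset : pairNodes α β μ = t := by
    rw [← Finset.image_orderEmbOfFin_univ t ht, ← hx]
    ext z
    simp only [pairNodes, Finset.mem_insert, Finset.mem_union, Finset.mem_image, Finset.mem_univ,
      true_and]
    constructor
    · rintro (rfl | ⟨i, rfl⟩ | ⟨i, rfl⟩) <;> exact ⟨_, rfl⟩
    · rintro ⟨⟨j, hj⟩, rfl⟩
      obtain ⟨k, rfl | rfl⟩ := Nat.even_or_odd' j
      · by_cases hk : k = n
        · subst hk
          exact Or.inl rfl
        · exact Or.inr (Or.inl ⟨⟨k, by omega⟩, rfl⟩)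
      · exact Or.inr (Or.inr ⟨⟨k, by omega⟩, rfl⟩)
  rw [← hset]
  exact h.finsetDividedDifference_pairNodes_nonneg hn hq hαβ hsep hμn (fun i => htI _ (hxt _))
    (fun i => htI _ (hxt _)) (htI _ (hxt _))

end Bisection

theorem theorem1p4 (n : ℕ) (hn : 1 ≤ n) (a b : EReal) (f : ℝ → ℝ) :
    MatrixConvexOfOrder n a b f ↔
      ∀ q : Polynomial ℝ, q.natDegree ≤ n - 1 →
        ∀ x : Fin (2 * n + 1) → ℝ, Function.Injective x → (∀ i, x i ∈ openInterval a b) →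
          0 ≤ dividedDifference (fun y => f y * q.eval y ^ 2) (2 * n) x := by
  rw [← dividedDifferenceCondition_iff]
  exact ⟨fun h => h.dividedDifferenceCondition hn, fun h => h.matrixConvexOfOrder hn⟩
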